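/- All manifolds are smooth, finite-dimensional and without boundary, and $\Gamma(\cdot)$ denotes smooth sections, possibly only defined on open sets. Let $(M,g_M)$ be a Riemannian manifold with Levi-Civita connection $\nabla^M$, and let $(N,g_N,P)$ be a Kähler manifold with Levi-Civita connection $\nabla^N$: $P$ is a smooth $(1,1)$-tensor field with $P^2=-I$, $g_N(P\cdot,P\cdot)=g_N$ and $\nabla^N P=0$. Let $F:M\to N$ be a smooth map with differential $F_*$, and assume the following. 1. $F$ is a *Riemannian map*: $g_N(F_*X,F_*Y)=g_M(X,Y)$ for all $X,Y\in(\ker F_{*q})^\perp$, $q\in M$. 2. $F$ is *semi-invariant*: there are smooth subbundles $D_1,D_2$ of $F^{-1}TN$ with $\operatorname{range}F_*=D_1\oplus D_2$, $P(D_1)=D_1$ and $P(D_2)\subseteq(\operatorname{range}F_*)^\perp$. 3. $F$ is *Clairaut with $s=e^f$*, where $f:N\to\mathbb R$ is smooth: $\operatorname{range}F_*$ is given by a smooth distribution $R$ on an open set $W\supseteq F(M)$ of $N$ (for instance $W=N$), that is, $R_{F(q)}=\operatorname{range}F_{*q}$ for all $q\in M$, and for every geodesic $\beta$ of $N$ (defined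 on an open interval) that runs in $W$, the function $t\mapsto s(\beta(t))\sin\theta(t)$ is constant, where $\theta(t)$ is the angle between $\dot\beta(t)$ and its component $V(t)$ in $R^\perp$ (with $\sin\theta(t)=1$ if $V(t)=0$). 4. $\dim D_2>1$ at every point. For $i=1,2$ let $\bar D_i=\{X\in(\ker F_*)^\perp : F_*X\in D_i\}$, so that $(\ker F_*)^\perp=\bar D_1\oplus\bar D_2$. Let $(\nabla F_*)(X,Y)=\nabla^F_X(F_*Y)-F_*(\nabla^M_XY)$ be the second fundamental form of $F$, where $\nabla^F$ is the pullback of $\nabla^N$ to $F^{-1}TN$. A smooth distribution $\bar D$ on $M$ is said to define a totally geodesic foliation if it is involutive and $\nabla^M_XY\in\Gamma(\bar D)$ for all $X,Y\in\Gamma(\bar D)$ (that is, its leaves are totally geodesic). Then: (i) $\bar D_1$ defines a totally geodesic foliation if and only if $(\nabla F_*)(X,U)$ has no component in $D_1$ (its orthogonal projection to $D_1$ vanishes) for all $X\in\Gamma(\bar D_1)$ and $U\in\Gamma(\ker F_*)$. (ii) $\bar D_2$ defines a totally geodesic foliation if and only if $(\nabla F_*)(X_2,U)$ has no component in $D_2$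 for all $X_2\in\Gamma(\bar D_2)$ and $U\in\Gamma(\ker F_*)$. -/

import Mathlib

open Bundle Manifold VectorField
open scoped ContDiff Topology

noncomputable section

namespace RiemMap

section LeviCivita

variable (E : Type*) [NormedAddCommGroup E] [NormedSpace ℝ E]
  (M : Type*) [TopologicalSpace M] [ChartedSpace E M] [IsManifold 𝓘(ℝ, E) ∞ M]

/-- Smooth Riemannian metrics on a manifold without boundary modelled on `E`. -/
abbrev RMetric : Type _ :=
  ContMDiffRiemannianMetric 𝓘(ℝ, E) ∞ E (fun x : M ↦ TangentSpace 𝓘(ℝ, E) x)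

variable {E M} (g : RMetric E M)

theorem mdifferentiableAt_metric {X Y : Π x : M, TangentSpace 𝓘(ℝ, E) x} {x : M}
    (hX : MDiffAt (T% X) x) (hY : MDiffAt (T% Y) x) :
    MDiffAt (fun y ↦ g.inner y (X y) (Y y)) x := by
  have hg := (g.contMDiff x).mdifferentiableAt (by simp)
  have : MDifferentiableAt 𝓘(ℝ, E) (𝓘(ℝ, E).prod 𝓘(ℝ))
      (fun m ↦ TotalSpace.mk' ℝ (E := Bundle.Trivial M ℝ) m (g.inner m (X m) (Y m))) x := by
    apply MDifferentiableAt.clm_bundle_apply₂ (F₁ := E) (F₂ := E)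
    · exact hg
    · exact hX
    · exact hY
  exact (by simpa [mdifferentiableAt_totalSpace] using this :
    _ ∧ MDiffAt (fun y ↦ g.inner y (X y) (Y y)) x).2

/-- The right-hand side of the Koszul formula
`2 g(∇_X Y, Z) = X g(Y, Z) + Y g(X, Z) - Z g(X, Y) + g([X, Y], Z) - g([X, Z], Y) - g([Y, Z], X)`. -/
def koszul (X Y Z : Π x : M, TangentSpace 𝓘(ℝ, E) x) (x : M) : ℝ :=
  mvfderiv 𝓘(ℝ, E) (fun y ↦ g.inner y (Y y) (Z y)) x (X x)
    + mvfderiv 𝓘(ℝ, E) (fun y ↦ g.inner y (X y) (Z y)) x (Y x)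
    - mvfderiv 𝓘(ℝ, E) (fun y ↦ g.inner y (X y) (Y y)) x (Z x)
    + g.inner x (mlieBracket 𝓘(ℝ, E) X Y x) (Z x)
    - g.inner x (mlieBracket 𝓘(ℝ, E) X Z x) (Y x)
    - g.inner x (mlieBracket 𝓘(ℝ, E) Y Z x) (X x)

/-- The metric at a point as a bilinear form on the tangent space. -/
def bilin (x : M) : LinearMap.BilinForm ℝ (TangentSpace 𝓘(ℝ, E) x) :=
  LinearMap.mk₂ ℝ (fun v w ↦ g.inner x v w) (by simp) (by simp) (by simp) (by simp)

theorem bilin_nondegenerate (x : M) : (bilin g x).Nondegenerate := by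
  constructor
  · intro v hv
    by_contra h
    exact (g.pos x v h).ne' (hv v)
  · intro v hv
    by_contra h
    exact (g.pos x v h).ne' (hv v)

theorem eq_of_inner_eq {x : M} {v w : TangentSpace 𝓘(ℝ, E) x}
    (h : ∀ z, 2 * g.inner x v z = 2 * g.inner x w z) : v = w := by
  by_contra hne
  have h0 := g.pos x (v - w) (sub_ne_zero.2 hne)
  have h1 := h (v - w)
  simp only [map_sub, _root_.sub_apply] at h0 h1
  linarith

variable [FiniteDimensional ℝ E]

theorem koszul_tensorial_left {Y Z : Π x : M, TangentSpace 𝓘(ℝ, E) x} {x : M}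
    (hY : MDiffAt (T% Y) x) (hZ : MDiffAt (T% Z) x) :
    TensorialAt 𝓘(ℝ, E) E (fun X ↦ koszul g X Y Z x) x where
  smul {f X} hf hX := by
    have h1 := mvfderiv_fun_mul hf (mdifferentiableAt_metric g hX hZ)
    have h2 := mvfderiv_fun_mul hf (mdifferentiableAt_metric g hX hY)
    simp [koszul, mlieBracket_smul_left hf hX, h1, h2]
    ring
  add {X X'} hX hX' := by
    have h1 := mvfderiv_fun_add (mdifferentiableAt_metric g hX hZ)
      (mdifferentiableAt_metric g hX' hZ)
    have h2 := mvfderiv_fun_add (mdifferentiableAt_metric g hX hY)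
      (mdifferentiableAt_metric g hX' hY)
    simp [koszul, mlieBracket_add_left hX hX', h1, h2]
    ring

theorem koszul_tensorial_right {X Y : Π x : M, TangentSpace 𝓘(ℝ, E) x} {x : M}
    (hX : MDiffAt (T% X) x) (hY : MDiffAt (T% Y) x) :
    TensorialAt 𝓘(ℝ, E) E (fun Z ↦ koszul g X Y Z x) x where
  smul {f Z} hf hZ := by
    have h1 := mvfderiv_fun_mul hf (mdifferentiableAt_metric g hX hZ)
    have h2 := mvfderiv_fun_mul hf (mdifferentiableAt_metric g hY hZ)
    simp [koszul, mlieBracket_smul_right hf hZ, h1, h2, g.symm x (Z x)]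
    ring
  add {Z Z'} hZ hZ' := by
    have h1 := mvfderiv_fun_add (mdifferentiableAt_metric g hX hZ)
      (mdifferentiableAt_metric g hX hZ')
    have h2 := mvfderiv_fun_add (mdifferentiableAt_metric g hY hZ)
      (mdifferentiableAt_metric g hY hZ')
    simp [koszul, mlieBracket_add_right hZ hZ', h1, h2]
    ring

theorem koszul_add {X Y Y' Z : Π x : M, TangentSpace 𝓘(ℝ, E) x} {x : M}
    (hX : MDiffAt (T% X) x) (hY : MDiffAt (T% Y) x) (hY' : MDiffAt (T% Y') x)
    (hZ : MDiffAt (T% Z) x) :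
    koszul g X (Y + Y') Z x = koszul g X Y Z x + koszul g X Y' Z x := by
  have h1 := mvfderiv_fun_add (mdifferentiableAt_metric g hY hZ)
    (mdifferentiableAt_metric g hY' hZ)
  have h2 := mvfderiv_fun_add (mdifferentiableAt_metric g hX hY)
    (mdifferentiableAt_metric g hX hY')
  simp [koszul, mlieBracket_add_right hY hY', mlieBracket_add_left hY hY', h1, h2]
  ring

theorem koszul_smul {f : M → ℝ} {X Y Z : Π x : M, TangentSpace 𝓘(ℝ, E) x} {x : M}
    (hf : MDiffAt f x) (hX : MDiffAt (T% X) x) (hY : MDiffAt (T% Y) x) (hZ : MDiffAt (T% Z) x) :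
    koszul g X (f • Y) Z x =
      f x * koszul g X Y Z x + 2 * mvfderiv 𝓘(ℝ, E) f x (X x) * g.inner x (Y x) (Z x) := by
  have h1 := mvfderiv_fun_mul hf (mdifferentiableAt_metric g hY hZ)
  have h2 := mvfderiv_fun_mul hf (mdifferentiableAt_metric g hX hY)
  simp [koszul, mlieBracket_smul_right hf hY, mlieBracket_smul_left hf hY, h1, h2,
    g.symm x (X x) (Y x)]
  ring

instance (x : M) : FiniteDimensional ℝ (TangentSpace 𝓘(ℝ, E) x) :=
  inferInstanceAs (FiniteDimensional ℝ E)

instance (x : M) : T2Space (TangentSpace 𝓘(ℝ, E) x) :=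
  inferInstanceAs (T2Space E)

/-- The tangent vector representing a linear form with respect to the metric. -/
def sharp (x : M) : (TangentSpace 𝓘(ℝ, E) x →L[ℝ] ℝ) →ₗ[ℝ] TangentSpace 𝓘(ℝ, E) x :=
  ((bilin g x).toDual (bilin_nondegenerate g x)).symm.toLinearMap ∘ₗ
    ContinuousLinearMap.coeLM ℝ

theorem inner_sharp (x : M) (φ : TangentSpace 𝓘(ℝ, E) x →L[ℝ] ℝ) (w : TangentSpace 𝓘(ℝ, E) x) :
    g.inner x (sharp g x φ) w = φ w :=
  LinearMap.BilinForm.apply_toDual_symm_apply (B := bilin g x) (hB := bilin_nondegenerate g x)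
    (f := (φ : TangentSpace 𝓘(ℝ, E) x →ₗ[ℝ] ℝ)) (v := w)

open Classical in
/-- `leviCivitaFun g Y x v` is the vector `∇_v Y` given by the Koszul formula, for a vector field
`Y` that is differentiable at `x`. -/
def leviCivitaFun (Y : Π x : M, TangentSpace 𝓘(ℝ, E) x) (x : M) :
    TangentSpace 𝓘(ℝ, E) x →L[ℝ] TangentSpace 𝓘(ℝ, E) x :=
  if hY : MDiffAt (T% Y) x then
    LinearMap.toContinuousLinearMap (sharp g x ∘ₗ ((2⁻¹ : ℝ) •
      (TensorialAt.mkHom₂ (fun X Z ↦ koszul g X Y Z x) x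
        (fun _ hZ ↦ koszul_tensorial_left g hY hZ)
        (fun _ hX ↦ koszul_tensorial_right g hX hY)).toLinearMap))
  else 0

theorem leviCivitaFun_koszul {X Y Z : Π x : M, TangentSpace 𝓘(ℝ, E) x} {x : M}
    (hX : MDiffAt (T% X) x) (hY : MDiffAt (T% Y) x) (hZ : MDiffAt (T% Z) x) :
    2 * g.inner x (leviCivitaFun g Y x (X x)) (Z x) = koszul g X Y Z x := by
  have := TensorialAt.mkHom₂_apply (Φ := fun X Z ↦ koszul g X Y Z x)
    (fun _ hZ ↦ koszul_tensorial_left g hY hZ) (fun _ hX ↦ koszul_tensorial_right g hX hY) hX hZ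
  rw [← this]
  simp [leviCivitaFun, hY, inner_sharp]

/-- The Levi-Civita connection of a Riemannian metric; `leviCivita g Y x (X x)` is `∇_X Y` at `x`. -/
def leviCivita : CovariantDerivative 𝓘(ℝ, E) E (fun x : M ↦ TangentSpace 𝓘(ℝ, E) x) where
  toFun := leviCivitaFun g
  isCovariantDerivativeOnUniv :=
    { add := by
        intro Y Y' x hY hY' _
        ext v
        refine eq_of_inner_eq g fun z ↦ ?_
        have hv := FiberBundle.mdifferentiableAt_extend 𝓘(ℝ, E) E v
        have hz := FiberBundle.mdifferentiableAt_extend 𝓘(ℝ, E) E z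
        have h1 := leviCivitaFun_koszul g hv (mdifferentiableAt_add_section hY hY') hz
        have h2 := leviCivitaFun_koszul g hv hY hz
        have h3 := leviCivitaFun_koszul g hv hY' hz
        rw [koszul_add g hv hY hY' hz] at h1
        simp only [FiberBundle.extend_apply_self] at h1 h2 h3
        rw [h1, ← h2, ← h3]
        simp
        ring
      leibniz := by
        intro Y f x hY hf _
        ext v
        refine eq_of_inner_eq g fun z ↦ ?_
        have hv := FiberBundle.mdifferentiableAt_extend 𝓘(ℝ, E) E v
        have hz := FiberBundle.mdifferentiableAt_extend 𝓘(ℝ, E) E z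
        have h1 := leviCivitaFun_koszul g hv (hf.smul_section hY) hz
        have h2 := leviCivitaFun_koszul g hv hY hz
        rw [koszul_smul g hf hv hY hz] at h1
        simp only [FiberBundle.extend_apply_self] at h1 h2
        erw [h1]
        rw [← h2]
        simp
        ring }

/-- The Levi-Civita connection is torsion-free. -/
theorem leviCivita_torsion {X Y : Π x : M, TangentSpace 𝓘(ℝ, E) x} {x : M}
    (hX : MDiffAt (T% X) x) (hY : MDiffAt (T% Y) x) :
    leviCivita g Y x (X x) - leviCivita g X x (Y x) = mlieBracket 𝓘(ℝ, E) X Y x := by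
  refine eq_of_inner_eq g fun z ↦ ?_
  have hz := FiberBundle.mdifferentiableAt_extend 𝓘(ℝ, E) E z
  have h1 := leviCivitaFun_koszul g hX hY hz
  have h2 := leviCivitaFun_koszul g hY hX hz
  have h3 := mlieBracket_swap_apply (I := 𝓘(ℝ, E)) (V := Y) (W := X) (x := x)
  have h4 : (fun y ↦ g.inner y (Y y) (X y)) = fun y ↦ g.inner y (X y) (Y y) := by
    ext y; exact g.symm y _ _
  simp only [koszul, h3, h4, FiberBundle.extend_apply_self, map_neg,
    _root_.neg_apply] at h1 h2
  simp only [map_sub, _root_.sub_apply]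
  change 2 * (g.inner x (leviCivitaFun g Y x (X x)) z - g.inner x (leviCivitaFun g X x (Y x)) z) = _
  linarith

/-- The Levi-Civita connection is compatible with the metric. -/
theorem leviCivita_metric {X Y Z : Π x : M, TangentSpace 𝓘(ℝ, E) x} {x : M}
    (hX : MDiffAt (T% X) x) (hY : MDiffAt (T% Y) x) (hZ : MDiffAt (T% Z) x) :
    mvfderiv 𝓘(ℝ, E) (fun y ↦ g.inner y (Y y) (Z y)) x (X x) =
      g.inner x (leviCivita g Y x (X x)) (Z x) + g.inner x (Y x) (leviCivita g Z x (X x)) := by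
  have h1 := leviCivitaFun_koszul g hX hY hZ
  have h2 := leviCivitaFun_koszul g hX hZ hY
  have h3 := mlieBracket_swap_apply (I := 𝓘(ℝ, E)) (V := Z) (W := Y) (x := x)
  have h4 : (fun y ↦ g.inner y (Z y) (Y y)) = fun y ↦ g.inner y (Y y) (Z y) := by
    ext y; exact g.symm y _ _
  simp only [koszul, h3, h4, map_neg, _root_.neg_apply] at h1 h2
  rw [g.symm x (Y x)]
  change _ = g.inner x (leviCivitaFun g Y x (X x)) (Z x) +
    g.inner x (leviCivitaFun g Z x (X x)) (Y x)
  linarith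

end LeviCivita

section Maps

variable {EA : Type*} [NormedAddCommGroup EA] [NormedSpace ℝ EA]
  {A : Type*} [TopologicalSpace A] [ChartedSpace EA A]
  {E : Type*} [NormedAddCommGroup E] [NormedSpace ℝ E] [FiniteDimensional ℝ E]
  {M : Type*} [TopologicalSpace M] [ChartedSpace E M] [IsManifold 𝓘(ℝ, E) ∞ M]
  {E' : Type*} [NormedAddCommGroup E'] [NormedSpace ℝ E'] [FiniteDimensional ℝ E']
  {N : Type*} [TopologicalSpace N] [ChartedSpace E' N] [IsManifold 𝓘(ℝ, E') ∞ N]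

/-- The orthogonal complement of a subspace of a tangent space. -/
def perp (g : RMetric E M) {x : M} (S : Submodule ℝ (TangentSpace 𝓘(ℝ, E) x)) :
    Submodule ℝ (TangentSpace 𝓘(ℝ, E) x) :=
  (bilin g x).orthogonal S

/-- The angle in `[0, π]` between two tangent vectors. If one of them is zero, it is `π / 2`. -/
def angle (g : RMetric E M) {x : M} (v w : TangentSpace 𝓘(ℝ, E) x) : ℝ :=
  Real.arccos (g.inner x v w / (√(g.inner x v v) * √(g.inner x w w)))

/-- The covariant derivative `∇^b_v V` (for the pullback by `b : A → N` of the Levi-Civita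
connection of `N`) of a vector field `V` along `b`, in the direction `v` tangent to `A` at `a`.
With `V = ∑ Vⁱ (eᵢ ∘ b)` in a local frame `(eᵢ)` of `TN` around `b a`, it is
`∑ (v(Vⁱ) eᵢ + Vⁱ ∇_{b_* v} eᵢ)`. -/
def covDerivAlong (g : RMetric E' N) (b : A → N) (V : Π a : A, TangentSpace 𝓘(ℝ, E') (b a))
    (a : A) (v : TangentSpace 𝓘(ℝ, EA) a) : TangentSpace 𝓘(ℝ, E') (b a) :=
  let e := trivializationAt E' (fun y : N ↦ TangentSpace 𝓘(ℝ, E') y) (b a)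
  let B := Module.finBasis ℝ E'
  ∑ i, (mvfderiv 𝓘(ℝ, EA) (fun a' ↦ e.localFrameCoeff 𝓘(ℝ, E') B i (b a') (V a')) a v •
        e.localFrame B i (b a)
      + e.localFrameCoeff 𝓘(ℝ, E') B i (b a) (V a) •
        leviCivita g (e.localFrame B i) (b a) (mfderiv 𝓘(ℝ, EA) 𝓘(ℝ, E') b a v))

/-- The velocity of a curve. -/
def velocity (β : ℝ → N) (t : ℝ) : TangentSpace 𝓘(ℝ, E') (β t) :=
  mfderiv 𝓘(ℝ, ℝ) 𝓘(ℝ, E') β t (1 : ℝ)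

/-- The curve `β` is a geodesic of `(N, g)` on the open set `J`: it is `C^2` (hence smooth) there and
`∇_{β'} β' = 0`. -/
def IsGeodesicOn (g : RMetric E' N) (β : ℝ → N) (J : Set ℝ) : Prop :=
  ContMDiffOn 𝓘(ℝ, ℝ) 𝓘(ℝ, E') 2 β J ∧
    ∀ t ∈ J, covDerivAlong (EA := ℝ) g β (velocity (E' := E') β) t (1 : ℝ) = 0

/-- On the set `S`, the family `D` of subspaces of the spaces `T_{b(a)} N` is a smooth subbundle of
the pullback `b^{-1} TN`: around each point it is spanned by a smooth local frame. -/
def IsSmoothSubbundleOn (b : A → N) (D : Π a : A, Submodule ℝ (TangentSpace 𝓘(ℝ, E') (b a)))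
    (S : Set A) : Prop :=
  ∀ a ∈ S, ∃ U : Set A, IsOpen U ∧ a ∈ U ∧
    ∃ (k : ℕ) (e : Fin k → Π a : A, TangentSpace 𝓘(ℝ, E') (b a)),
      (∀ i, ContMDiffOn 𝓘(ℝ, EA) (𝓘(ℝ, E').prod 𝓘(ℝ, E')) ∞
        (fun a ↦ (⟨b a, e i a⟩ : TangentBundle 𝓘(ℝ, E') N)) U) ∧
      ∀ a ∈ U, LinearIndependent ℝ (fun i ↦ e i a) ∧
        Submodule.span ℝ (Set.range (fun i ↦ e i a)) = D a

/-- Smooth vector fields on the open set `U` that are tangent to `D`, i.e. `Γ(U, D)`. -/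
def IsSectionOn (D : Π x : M, Submodule ℝ (TangentSpace 𝓘(ℝ, E) x)) (U : Set M)
    (X : Π x : M, TangentSpace 𝓘(ℝ, E) x) : Prop :=
  ContMDiffOn 𝓘(ℝ, E) (𝓘(ℝ, E).prod 𝓘(ℝ, E)) ∞ (fun x ↦ (⟨x, X x⟩ : TangentBundle 𝓘(ℝ, E) M)) U ∧
    ∀ x ∈ U, X x ∈ D x

/-- The distribution `D` defines a totally geodesic foliation: it is smooth and involutive, and the
second fundamental form of its leaves vanishes, that is, `∇_X Y` is tangent to `D` whenever
`X` and `Y` are. -/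
structure IsTotallyGeodesicFoliation (g : RMetric E M)
    (D : Π x : M, Submodule ℝ (TangentSpace 𝓘(ℝ, E) x)) : Prop where
  smooth : IsSmoothSubbundleOn (EA := E) (A := M) (N := M) (fun x ↦ x) D Set.univ
  involutive : ∀ U : Set M, IsOpen U → ∀ X Y, IsSectionOn D U X → IsSectionOn D U Y →
    ∀ x ∈ U, mlieBracket 𝓘(ℝ, E) X Y x ∈ D x
  totallyGeodesic : ∀ U : Set M, IsOpen U → ∀ X Y, IsSectionOn D U X → IsSectionOn D U Y →
    ∀ x ∈ U, leviCivita g Y x (X x) ∈ D x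

/-- `(N, g, P)` is a Kähler manifold: `P` is a smooth tensor field of type `(1, 1)` with `P² = -1`,
`g(PX, PY) = g(X, Y)` and `∇P = 0`. -/
structure IsKahler (g : RMetric E' N)
    (P : Π y : N, TangentSpace 𝓘(ℝ, E') y →L[ℝ] TangentSpace 𝓘(ℝ, E') y) : Prop where
  smooth : ContMDiff 𝓘(ℝ, E') (𝓘(ℝ, E').prod 𝓘(ℝ, E' →L[ℝ] E')) ∞
    (fun y ↦ TotalSpace.mk' (E' →L[ℝ] E')
      (E := fun y : N ↦ TangentSpace 𝓘(ℝ, E') y →L[ℝ] TangentSpace 𝓘(ℝ, E') y) y (P y))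
  sq : ∀ y v, P y (P y v) = -v
  isometry : ∀ y v w, g.inner y (P y v) (P y w) = g.inner y v w
  parallel : ∀ (Y : Π y : N, TangentSpace 𝓘(ℝ, E') y) (y : N), MDiffAt (T% Y) y →
    ∀ v, leviCivita g (fun z ↦ P z (Y z)) y v = P y (leviCivita g Y y v)

/-- The vertical space `ker F_*` at `q`. -/
def ker (F : M → N) (q : M) : Submodule ℝ (TangentSpace 𝓘(ℝ, E) q) :=
  LinearMap.ker (mfderiv 𝓘(ℝ, E) 𝓘(ℝ, E') F q).toLinearMap

/-- The space `range F_*` at `q`, a subspace of `T_{F(q)} N`. -/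
def range (F : M → N) (q : M) : Submodule ℝ (TangentSpace 𝓘(ℝ, E') (F q)) :=
  LinearMap.range (mfderiv 𝓘(ℝ, E) 𝓘(ℝ, E') F q).toLinearMap

/-- `F` is a Riemannian map: `F_*` is isometric on `(ker F_*)^⊥`. -/
structure IsRiemannianMap (gM : RMetric E M) (gN : RMetric E' N) (F : M → N) : Prop where
  smooth : ContMDiff 𝓘(ℝ, E) 𝓘(ℝ, E') ∞ F
  isometry : ∀ q, ∀ v ∈ perp gM (ker (E := E) (E' := E') F q),
    ∀ w ∈ perp gM (ker (E := E) (E' := E') F q),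
    gN.inner (F q) (mfderiv 𝓘(ℝ, E) 𝓘(ℝ, E') F q v) (mfderiv 𝓘(ℝ, E) 𝓘(ℝ, E') F q w) =
      gM.inner q v w

/-- `F` is a semi-invariant Riemannian map with respect to the orthogonal splitting
`range F_* = D₁ ⊕ D₂` into smooth subbundles, `P D₁ = D₁` and `P D₂ ⊆ (range F_*)^⊥`. -/
structure IsSemiInvariant (gM : RMetric E M) (gN : RMetric E' N)
    (P : Π y : N, TangentSpace 𝓘(ℝ, E') y →L[ℝ] TangentSpace 𝓘(ℝ, E') y) (F : M → N)
    (D₁ D₂ : Π q : M, Submodule ℝ (TangentSpace 𝓘(ℝ, E') (F q))) : Prop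
    extends IsRiemannianMap gM gN F where
  smooth₁ : IsSmoothSubbundleOn (EA := E) F D₁ Set.univ
  smooth₂ : IsSmoothSubbundleOn (EA := E) F D₂ Set.univ
  disjoint : ∀ q, Disjoint (D₁ q) (D₂ q)
  sup_eq : ∀ q, D₁ q ⊔ D₂ q = range (E := E) (E' := E') F q
  invariant : ∀ q, (D₁ q).map (P (F q)).toLinearMap = D₁ q
  antiInvariant : ∀ q, (D₂ q).map (P (F q)).toLinearMap ≤ perp gN (range (E := E) (E' := E') F q)

/-- `F` satisfies the Clairaut condition with the function `s > 0`: `s(β(t)) sin θ(t)` is constant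
along every geodesic `β` of `N`, where `θ(t)` is the angle between `β'(t)` and its
component `V` in `(range F_*)^⊥`. For this to make sense along `β`, the field of subspaces `range F_*`
is a smooth distribution `R` of an open set `W ⊇ F(M)` (e.g. `W = N`), and `β` runs in `W`. -/
def IsClairaut (gN : RMetric E' N) (F : M → N) (s : N → ℝ) : Prop :=
  (∀ y, 0 < s y) ∧
  ∃ (W : Set N) (R : Π y : N, Submodule ℝ (TangentSpace 𝓘(ℝ, E') y)),
    IsOpen W ∧ Set.range F ⊆ W ∧
    IsSmoothSubbundleOn (EA := E') (A := N) (N := N) (fun y ↦ y) R W ∧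
    (∀ q, R (F q) = range (E := E) (E' := E') F q) ∧
    ∀ (β : ℝ → N) (J : Set ℝ), IsOpen J → J.OrdConnected → (∀ t ∈ J, β t ∈ W) →
      IsGeodesicOn gN β J →
      ∃ c : ℝ, ∀ t ∈ J, ∀ V ∈ perp gN (R (β t)), velocity (E' := E') β t - V ∈ R (β t) →
        s (β t) * Real.sin (angle gN (velocity (E' := E') β t) V) = c

/-- `F` is a Clairaut semi-invariant Riemannian map with function `s`. -/
structure IsCSIRM (gM : RMetric E M) (gN : RMetric E' N)
    (P : Π y : N, TangentSpace 𝓘(ℝ, E') y →L[ℝ] TangentSpace 𝓘(ℝ, E') y) (F : M → N)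
    (D₁ D₂ : Π q : M, Submodule ℝ (TangentSpace 𝓘(ℝ, E') (F q))) (s : N → ℝ) : Prop
    extends IsSemiInvariant gM gN P F D₁ D₂ where
  clairaut : IsClairaut (E := E) gN F s

/-- The distribution `D̄ ⊆ (ker F_*)^⊥` that corresponds to `D ⊆ range F_*`. -/
def lift (gM : RMetric E M) (F : M → N)
    (D : Π q : M, Submodule ℝ (TangentSpace 𝓘(ℝ, E') (F q))) (q : M) :
    Submodule ℝ (TangentSpace 𝓘(ℝ, E) q) :=
  perp gM (ker (E := E) (E' := E') F q) ⊓
    (D q).comap (mfderiv 𝓘(ℝ, E) 𝓘(ℝ, E') F q).toLinearMap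

/-- The second fundamental form `(∇F_*)(X, Y) = ∇^F_X (F_* Y) - F_* (∇_X Y)` of the map `F`. -/
def secondFundamentalForm (gM : RMetric E M) (gN : RMetric E' N) (F : M → N)
    (X Y : Π x : M, TangentSpace 𝓘(ℝ, E) x) (q : M) : TangentSpace 𝓘(ℝ, E') (F q) :=
  covDerivAlong (EA := E) gN F (fun p ↦ mfderiv 𝓘(ℝ, E) 𝓘(ℝ, E') F p (Y p)) q (X q)
    - mfderiv 𝓘(ℝ, E) 𝓘(ℝ, E') F q (leviCivita gM Y q (X q))

/-- `(∇F_*)(X, U)` has no component in `D ⊆ range F_*` for `X ∈ Γ(D̄)` and `U ∈ Γ(ker F_*)`: its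
orthogonal projection to `D` vanishes. -/
def NoComponent (gM : RMetric E M) (gN : RMetric E' N) (F : M → N)
    (D : Π q : M, Submodule ℝ (TangentSpace 𝓘(ℝ, E') (F q))) : Prop :=
  ∀ O : Set M, IsOpen O → ∀ X U, IsSectionOn (lift gM F D) O X →
    IsSectionOn (ker (E := E) (E' := E') F) O U →
    ∀ q ∈ O, secondFundamentalForm gM gN F X U q ∈ perp gN (D q)

end Maps

end RiemMap

end

open Bundle Manifold VectorField
open scoped ContDiff Topology

noncomputable section

/-! Let `D` be one of `D₁`, `D₂`, let `D'` be the other, and let X, Y be sections of the lift of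
`D`. The field ∇_X Y lies in that lift exactly when its vertical part and its part in the lift of
`D'` both vanish.

The vertical part carries the stated condition. If U is vertical, then g(Y, U) = 0 and F_* U = 0, so
g(∇_X Y, U) = -g(Y, ∇_X U) = g_N(F_* Y, (∇F_*)(X, U)) (`IsRiemannianMap.inner_leviCivita_vertical`).
Letting Y run through the lift of `D` turns this into `NoComponent`; see
`IsRiemannianMap.isTotallyGeodesicFoliation_lift_iff`. Involutivity then follows from the vanishing
of torsion.

The part in the lift of `D'` always vanishes, and this is where the Clairaut and Kähler conditions
act. Differentiating Clairaut's relation along geodesics gives g_N((∇F_*)(X, Y), n) = -g(X, Y) df(n)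
for horizontal X, Y and n normal to range F_* (`IsRiemannianMap.clairaut`). Next, df vanishes on P
D₂ (`IsCSIRM.mvfderiv_eq_zero`): given e in D₂, choose e' ≠ 0 in D₂ orthogonal to e and
differentiate g_N(P F_* Y, F_* Z) = 0 along Y, where F_* Y = e' and F_* Z = e at the point. What
remains is |e'|² df(Pe) = 0. Finally, for Y in the lift of D₁ and Z in the lift of D₂, since P is
parallel and isometric, g(∇_X Y, Z) = g_N(∇_X (P F_* Y), P F_* Z). This is a normal component of
∇F_*, hence a multiple of df(P F_* Z) = 0 (`IsCSIRM.inner_leviCivita₁`). Orthogonality of D₁ and D₂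
gives the same with the roles exchanged.

The earlier sections supply what this needs: the calculus of the pullback connection (metric,
torsion-free, commuting with P), local existence of geodesics, and smooth horizontal lifts by means
of the adjoint of F_*. -/

namespace RiemMap

set_option linter.unusedSectionVars false

/-! ### Vector fields along a map and the pullback connection. -/

section Along

variable {EA : Type*} [NormedAddCommGroup EA] [NormedSpace ℝ EA]
  {A : Type*} [TopologicalSpace A] [ChartedSpace EA A]
  {E' : Type*} [NormedAddCommGroup E'] [NormedSpace ℝ E'] [FiniteDimensional ℝ E']
  {N : Type*} [TopologicalSpace N] [ChartedSpace E' N] [IsManifold 𝓘(ℝ, E') ∞ N]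

/-- The vector field `V` along `b` is differentiable at `a`. -/
def MDiffAlongAt (EA : Type*) [NormedAddCommGroup EA] [NormedSpace ℝ EA]
    {A : Type*} [TopologicalSpace A] [ChartedSpace EA A] (b : A → N)
    (V : Π a : A, TangentSpace 𝓘(ℝ, E') (b a)) (a : A) : Prop :=
  MDifferentiableAt 𝓘(ℝ, EA) (𝓘(ℝ, E').prod 𝓘(ℝ, E'))
    (fun a ↦ (⟨b a, V a⟩ : TangentBundle 𝓘(ℝ, E') N)) a

/-- The preferred trivialization of the tangent bundle around a point. -/
abbrev tangentTriv (y : N) := trivializationAt E' (fun y : N ↦ TangentSpace 𝓘(ℝ, E') y) y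

variable {b : A → N} {V W : Π a : A, TangentSpace 𝓘(ℝ, E') (b a)} {a : A}

theorem MDiffAlongAt.base (hV : MDiffAlongAt EA b V a) :
    MDifferentiableAt 𝓘(ℝ, EA) 𝓘(ℝ, E') b a :=
  ((mdifferentiableAt_totalSpace (F := E') (E := fun y : N ↦ TangentSpace 𝓘(ℝ, E') y) 𝓘(ℝ, E') _).1 hV).1

theorem mdiffAlongAt_iff : MDiffAlongAt EA b V a ↔ MDifferentiableAt 𝓘(ℝ, EA) 𝓘(ℝ, E') b a ∧
    MDifferentiableAt 𝓘(ℝ, EA) 𝓘(ℝ, E') (fun a' ↦ (tangentTriv (E' := E') (b a) ⟨b a', V a'⟩).2) a :=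
  mdifferentiableAt_totalSpace (F := E') (E := fun y : N ↦ TangentSpace 𝓘(ℝ, E') y) 𝓘(ℝ, E') _

theorem eventually_mem_baseSet (hb : ContinuousAt b a) :
    ∀ᶠ a' in 𝓝 a, b a' ∈ (tangentTriv (E' := E') (b a)).baseSet :=
  hb.eventually ((tangentTriv (E' := E') (b a)).open_baseSet.mem_nhds
    (FiberBundle.mem_baseSet_trivializationAt' (b a)))

theorem MDiffAlongAt.add (hV : MDiffAlongAt EA b V a) (hW : MDiffAlongAt EA b W a) :
    MDiffAlongAt EA b (V + W) a := by
  rw [mdiffAlongAt_iff] at *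
  refine ⟨hV.1, (hV.2.add hW.2).congr_of_eventuallyEq ?_⟩
  filter_upwards [eventually_mem_baseSet (E' := E') hV.1.continuousAt] with a' ha'
  exact (Trivialization.linear (tangentTriv (E' := E') (b a)) (R := ℝ) ha').map_add
    (V a') (W a')

theorem MDiffAlongAt.smul {h : A → ℝ} (hh : MDifferentiableAt 𝓘(ℝ, EA) 𝓘(ℝ, ℝ) h a)
    (hV : MDiffAlongAt EA b V a) : MDiffAlongAt EA b (h • V) a := by
  rw [mdiffAlongAt_iff] at *
  refine ⟨hV.1, (hh.smul hV.2).congr_of_eventuallyEq ?_⟩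
  filter_upwards [eventually_mem_baseSet (E' := E') hV.1.continuousAt] with a' ha'
  exact (Trivialization.linear (tangentTriv (E' := E') (b a)) (R := ℝ) ha').map_smul
    (h a') (V a')

theorem mdiffAlongAt_zero (hb : MDifferentiableAt 𝓘(ℝ, EA) 𝓘(ℝ, E') b a) :
    MDiffAlongAt EA b (0 : Π a : A, TangentSpace 𝓘(ℝ, E') (b a)) a := by
  rw [mdiffAlongAt_iff]
  refine ⟨hb, (mdifferentiableAt_const (c := (0 : E'))).congr_of_eventuallyEq ?_⟩
  filter_upwards [eventually_mem_baseSet (E' := E') hb.continuousAt] with a' ha'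
  exact (Trivialization.linear (tangentTriv (E' := E') (b a)) (R := ℝ) ha').map_zero

theorem MDiffAlongAt.congr (hV : MDiffAlongAt EA b V a) (h : ∀ᶠ a' in 𝓝 a, W a' = V a') :
    MDiffAlongAt EA b W a :=
  MDifferentiableAt.congr_of_eventuallyEq hV (h.mono fun a' h ↦ by simp [h])

theorem MDiffAlongAt.sum {ι : Type*} (s : Finset ι) {V : ι → Π a : A, TangentSpace 𝓘(ℝ, E') (b a)}
    (hb : MDifferentiableAt 𝓘(ℝ, EA) 𝓘(ℝ, E') b a)
    (hV : ∀ i ∈ s, MDiffAlongAt EA b (V i) a) : MDiffAlongAt EA b (∑ i ∈ s, V i) a := by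
  classical
  induction s using Finset.induction_on with
  | empty => simpa using mdiffAlongAt_zero hb
  | insert i s hi ih =>
    rw [Finset.sum_insert hi]
    exact (hV i (by simp)).add (ih fun j hj ↦ hV j (by simp [hj]))

theorem mdiffAlongAt_comp {Y : Π y : N, TangentSpace 𝓘(ℝ, E') y}
    (hb : MDifferentiableAt 𝓘(ℝ, EA) 𝓘(ℝ, E') b a) (hY : MDiffAt (T% Y) (b a)) :
    MDiffAlongAt EA b (fun a ↦ Y (b a)) a :=
  MDifferentiableAt.comp a hY hb

theorem localFrameCoeff_tangentTriv {y y' : N} (hy : y' ∈ (tangentTriv (E' := E') y).baseSet)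
    (v : TangentSpace 𝓘(ℝ, E') y') (i) :
    (tangentTriv (E' := E') y).localFrameCoeff 𝓘(ℝ, E') (Module.finBasis ℝ E') i y' v =
      (Module.finBasis ℝ E').repr (tangentTriv (E' := E') y ⟨y', v⟩).2 i := by
  -- The coefficient depends only on the value at `y'`, so any section through `v` serves.
  have := (tangentTriv (E' := E') y).localFrameCoeff_eq_coeff (I := 𝓘(ℝ, E'))
    (b := Module.finBasis ℝ E') (s := FiberBundle.extend E' v) hy (i := i)
  simpa only [FiberBundle.extend_apply_self] using this

theorem sum_localFrameCoeff_tangentTriv {y y' : N} (hy : y' ∈ (tangentTriv (E' := E') y).baseSet)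
    (v : TangentSpace 𝓘(ℝ, E') y') :
    ∑ i, (tangentTriv (E' := E') y).localFrameCoeff 𝓘(ℝ, E') (Module.finBasis ℝ E') i y' v •
      (tangentTriv (E' := E') y).localFrame (Module.finBasis ℝ E') i y' = v := by
  have := (tangentTriv (E' := E') y).eq_sum_localFrameCoeff_smul (I := 𝓘(ℝ, E'))
    (b := Module.finBasis ℝ E') (s := FiberBundle.extend E' v) hy
  simpa only [FiberBundle.extend_apply_self] using this.symm

theorem mdifferentiableAt_localFrame {y y' : N} (hy : y' ∈ (tangentTriv (E' := E') y).baseSet) (i) :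
    MDiffAt (T% ((tangentTriv (E' := E') y).localFrame (Module.finBasis ℝ E') i)) y' :=
  (contMDiffAt_localFrame_of_mem 1 _ (Module.finBasis ℝ E') i hy).mdifferentiableAt (by simp)

theorem MDiffAlongAt.coeff (hV : MDiffAlongAt EA b V a) (i) :
    MDifferentiableAt 𝓘(ℝ, EA) 𝓘(ℝ, ℝ) (fun a' ↦
      (tangentTriv (E' := E') (b a)).localFrameCoeff 𝓘(ℝ, E')
        (Module.finBasis ℝ E') i (b a') (V a')) a := by
  have h := (mdiffAlongAt_iff.1 hV).2
  have h2 : MDifferentiableAt 𝓘(ℝ, E') 𝓘(ℝ, ℝ)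
      (LinearMap.toContinuousLinearMap ((Module.finBasis ℝ E').coord i))
      ((tangentTriv (E' := E') (b a) ⟨b a, V a⟩).2) :=
    ContinuousLinearMap.mdifferentiableAt _
  refine (h2.comp a h).congr_of_eventuallyEq ?_
  filter_upwards [eventually_mem_baseSet (E' := E') hV.base.continuousAt] with a' ha'
  rw [localFrameCoeff_tangentTriv ha']
  simp

variable (g : RMetric E' N)

theorem mvfderiv_congr {h h' : A → ℝ} (H : h =ᶠ[𝓝 a] h') :
    mvfderiv 𝓘(ℝ, EA) h a = mvfderiv 𝓘(ℝ, EA) h' a :=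
  H.mfderiv_eq

theorem covDerivAlong_congr (h : ∀ᶠ a' in 𝓝 a, V a' = W a') (v : TangentSpace 𝓘(ℝ, EA) a) :
    covDerivAlong (EA := EA) g b V a v = covDerivAlong g b W a v := by
  have h0 := h.self_of_nhds
  unfold covDerivAlong
  refine Finset.sum_congr rfl fun i _ ↦ ?_
  simp only [h0]
  congr 2
  have : (fun a' ↦ (tangentTriv (E' := E') (b a)).localFrameCoeff 𝓘(ℝ, E')
      (Module.finBasis ℝ E') i (b a') (V a')) =ᶠ[𝓝 a] (fun a' ↦
      (tangentTriv (E' := E') (b a)).localFrameCoeff 𝓘(ℝ, E')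
      (Module.finBasis ℝ E') i (b a') (W a')) := h.mono fun a' h ↦ by simp [h]
  rw [mvfderiv_congr this]

theorem covDerivAlong_add (hV : MDiffAlongAt EA b V a) (hW : MDiffAlongAt EA b W a) (v : TangentSpace 𝓘(ℝ, EA) a) :
    covDerivAlong g b (V + W) a v = covDerivAlong g b V a v + covDerivAlong g b W a v := by
  unfold covDerivAlong
  simp only [← Finset.sum_add_distrib]
  refine Finset.sum_congr rfl fun i _ ↦ ?_
  have := mvfderiv_fun_add (hV.coeff i) (hW.coeff i)
  simp only [Pi.add_apply, map_add, this, _root_.add_apply, add_smul]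
  abel

theorem covDerivAlong_smul {h : A → ℝ} (hh : MDifferentiableAt 𝓘(ℝ, EA) 𝓘(ℝ, ℝ) h a)
    (hV : MDiffAlongAt EA b V a) (v : TangentSpace 𝓘(ℝ, EA) a) :
    covDerivAlong g b (h • V) a v =
      mvfderiv 𝓘(ℝ, EA) h a v • V a + h a • covDerivAlong g b V a v := by
  conv_rhs => rw [← sum_localFrameCoeff_tangentTriv (FiberBundle.mem_baseSet_trivializationAt' (b a)) (V a)]
  unfold covDerivAlong
  simp only [Finset.smul_sum, ← Finset.sum_add_distrib]
  refine Finset.sum_congr rfl fun i _ ↦ ?_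
  have := mvfderiv_fun_mul hh (hV.coeff i)
  simp only [Pi.smul_apply', map_smul, smul_eq_mul, this, _root_.add_apply, _root_.smul_apply]
  module

theorem covDerivAlong_zero (v : TangentSpace 𝓘(ℝ, EA) a) :
    covDerivAlong (EA := EA) g b 0 a v = 0 := by
  have := mvfderiv_const (I := 𝓘(ℝ, EA)) (0 : ℝ) (x := a)
  simp [covDerivAlong, this]

theorem covDerivAlong_sum {ι : Type*} (s : Finset ι) {V : ι → Π a : A, TangentSpace 𝓘(ℝ, E') (b a)}
    (hb : MDifferentiableAt 𝓘(ℝ, EA) 𝓘(ℝ, E') b a)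
    (hV : ∀ i ∈ s, MDiffAlongAt EA b (V i) a) (v : TangentSpace 𝓘(ℝ, EA) a) :
    covDerivAlong g b (∑ i ∈ s, V i) a v = ∑ i ∈ s, covDerivAlong g b (V i) a v := by
  classical
  induction s using Finset.induction_on with
  | empty => simpa using covDerivAlong_zero g v
  | insert i s hi ih =>
    rw [Finset.sum_insert hi, Finset.sum_insert hi, covDerivAlong_add g (hV i (by simp))
      (MDiffAlongAt.sum s hb fun j hj ↦ hV j (by simp [hj])), ih fun j hj ↦ hV j (by simp [hj])]

theorem leviCivita_sum {ι : Type*} (s : Finset ι) {Y : ι → Π y : N, TangentSpace 𝓘(ℝ, E') y} {y : N}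
    (hY : ∀ i ∈ s, MDiffAt (T% (Y i)) y) :
    leviCivita g (∑ i ∈ s, Y i) y = ∑ i ∈ s, leviCivita g (Y i) y := by
  classical
  induction s using Finset.induction_on with
  | empty => simp
  | insert i s hi ih =>
    rw [Finset.sum_insert hi, Finset.sum_insert hi, (leviCivita g).isCovariantDerivativeOnUniv.add
      (hY i (by simp)) (MDiffAlongAt.sum (b := id) s mdifferentiableAt_id
        fun j hj ↦ hY j (by simp [hj])), ih fun j hj ↦ hY j (by simp [hj])]

/-- The covariant derivative of the restriction of a vector field. -/
theorem covDerivAlong_comp {Y : Π y : N, TangentSpace 𝓘(ℝ, E') y}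
    (hb : MDifferentiableAt 𝓘(ℝ, EA) 𝓘(ℝ, E') b a) (hY : MDiffAt (T% Y) (b a)) (v : TangentSpace 𝓘(ℝ, EA) a) :
    covDerivAlong g b (fun a ↦ Y (b a)) a v =
      leviCivita g Y (b a) (mfderiv 𝓘(ℝ, EA) 𝓘(ℝ, E') b a v) := by
  have hmem := FiberBundle.mem_baseSet_trivializationAt' (F := E')
    (E := fun y : N ↦ TangentSpace 𝓘(ℝ, E') y) (b a)
  have hc : ∀ i, MDifferentiableAt 𝓘(ℝ, E') 𝓘(ℝ, ℝ) (fun y ↦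
      (tangentTriv (E' := E') (b a)).localFrameCoeff 𝓘(ℝ, E') (Module.finBasis ℝ E') i y (Y y))
      (b a) := fun i ↦ MDiffAlongAt.coeff (b := id) (a := b a) (V := Y) hY i
  have hE := fun i ↦ mdifferentiableAt_localFrame (E' := E') hmem i
  -- Expanding `Y` in the frame and applying the Leibniz rule to each term reproduces the formula
  -- that defines `covDerivAlong`.
  have h1 : leviCivita g Y (b a) = leviCivita g (∑ i, (fun y ↦
      (tangentTriv (E' := E') (b a)).localFrameCoeff 𝓘(ℝ, E') (Module.finBasis ℝ E') i y (Y y)) •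
      (tangentTriv (E' := E') (b a)).localFrame (Module.finBasis ℝ E') i) (b a) := by
    refine (leviCivita g).isCovariantDerivativeOnUniv.congr_of_eventuallyEq hY ?_ Filter.univ_mem ?_
    · exact MDiffAlongAt.sum (b := id) _ mdifferentiableAt_id
        fun i _ ↦ MDiffAlongAt.smul (b := id) (hc i) (hE i)
    · filter_upwards [(tangentTriv (E' := E') (b a)).open_baseSet.mem_nhds hmem] with y hy
      simpa using (sum_localFrameCoeff_tangentTriv hy (Y y)).symm
  rw [h1, leviCivita_sum]
  swap
  · exact fun i _ ↦ MDiffAlongAt.smul (b := id) (hc i) (hE i)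
  simp only [covDerivAlong, _root_.sum_apply]
  refine Finset.sum_congr rfl fun i _ ↦ ?_
  rw [(leviCivita g).isCovariantDerivativeOnUniv.leibniz (hE i) (hc i)]
  have h2 := mvfderiv_comp_apply a (hc i) hb v
  simp only [Function.comp_def] at h2
  rw [h2]
  simp [add_comm]

/-- To prove a local linear property of vector fields along `b`, it suffices to consider
multiples of restrictions of vector fields. -/
theorem MDiffAlongAt.induction {p : (Π a : A, TangentSpace 𝓘(ℝ, E') (b a)) → Prop}
    (hV : MDiffAlongAt EA b V a)
    (congr : ∀ V W, (∀ᶠ a' in 𝓝 a, W a' = V a') → MDiffAlongAt EA b V a → p V → p W)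
    (zero : p 0)
    (add : ∀ V W, MDiffAlongAt EA b V a → MDiffAlongAt EA b W a → p V → p W → p (V + W))
    (smul : ∀ (h : A → ℝ) (Y : Π y : N, TangentSpace 𝓘(ℝ, E') y),
      MDifferentiableAt 𝓘(ℝ, EA) 𝓘(ℝ, ℝ) h a → MDiffAt (T% Y) (b a) →
        p (h • (fun a ↦ Y (b a)))) : p V := by
  classical
  have hmem := FiberBundle.mem_baseSet_trivializationAt' (F := E')
    (E := fun y : N ↦ TangentSpace 𝓘(ℝ, E') y) (b a)
  have hE := fun i ↦ mdifferentiableAt_localFrame (E' := E') hmem i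
  let T := fun i ↦ (fun a' ↦ (tangentTriv (E' := E') (b a)).localFrameCoeff 𝓘(ℝ, E')
    (Module.finBasis ℝ E') i (b a') (V a')) •
      (fun a' ↦ (tangentTriv (E' := E') (b a)).localFrame (Module.finBasis ℝ E') i (b a'))
  have hT : ∀ i, MDiffAlongAt EA b (T i) a :=
    fun i ↦ (mdiffAlongAt_comp hV.base (hE i)).smul (hV.coeff i)
  have key : ∀ s : Finset (Fin (Module.finrank ℝ E')), p (∑ i ∈ s, T i) := by
    intro s
    induction s using Finset.induction_on with
    | empty => simpa using zero
    | insert i s hi ih =>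
      rw [Finset.sum_insert hi]
      exact add _ _ (hT i) (MDiffAlongAt.sum s hV.base fun j _ ↦ hT j)
        (smul _ _ (hV.coeff i) (hE i)) ih
  refine congr _ _ ?_ (MDiffAlongAt.sum Finset.univ hV.base fun j _ ↦ hT j) (key Finset.univ)
  filter_upwards [eventually_mem_baseSet (E' := E') hV.base.continuousAt] with a' ha'
  simpa [T] using (sum_localFrameCoeff_tangentTriv ha' (V a')).symm

theorem MDiffAlongAt.inner (hV : MDiffAlongAt EA b V a) (hW : MDiffAlongAt EA b W a) :
    MDifferentiableAt 𝓘(ℝ, EA) 𝓘(ℝ, ℝ) (fun a ↦ g.inner (b a) (V a) (W a)) a := by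
  have hg := ((g.contMDiff (b a)).mdifferentiableAt (by simp)).comp a hV.base
  have : MDifferentiableAt 𝓘(ℝ, EA) (𝓘(ℝ, E').prod 𝓘(ℝ))
      (fun m ↦ TotalSpace.mk' ℝ (E := Bundle.Trivial N ℝ) (b m) (g.inner (b m) (V m) (W m))) a := by
    apply MDifferentiableAt.clm_bundle_apply₂ (F₁ := E') (F₂ := E')
    · exact hg
    · exact hV
    · exact hW
  exact (by simpa [mdifferentiableAt_totalSpace] using this :
    _ ∧ MDifferentiableAt 𝓘(ℝ, EA) 𝓘(ℝ, ℝ) (fun a ↦ g.inner (b a) (V a) (W a)) a).2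

/-- The pullback of the Levi-Civita connection is compatible with the metric. -/
theorem covDerivAlong_metric (hV : MDiffAlongAt EA b V a) (hW : MDiffAlongAt EA b W a) (v : TangentSpace 𝓘(ℝ, EA) a) :
    mvfderiv 𝓘(ℝ, EA) (fun a ↦ g.inner (b a) (V a) (W a)) a v =
      g.inner (b a) (covDerivAlong g b V a v) (W a) +
        g.inner (b a) (V a) (covDerivAlong g b W a v) := by
  have hb := hV.base
  -- Both sides are additive and obey the same Leibniz rule in each argument, so multiples of
  -- restrictions suffice. `W` stays universally quantified while `V` is reduced, and is reduced
  -- afterwards.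
  revert W
  refine hV.induction (p := fun V ↦ ∀ {W}, MDiffAlongAt EA b W a →
    mvfderiv 𝓘(ℝ, EA) (fun a ↦ g.inner (b a) (V a) (W a)) a v =
      g.inner (b a) (covDerivAlong g b V a v) (W a) +
        g.inner (b a) (V a) (covDerivAlong g b W a v)) ?_ ?_ ?_ ?_
  · intro V W h hV H Z hZ
    have : (fun a ↦ g.inner (b a) (W a) (Z a)) =ᶠ[𝓝 a] (fun a ↦ g.inner (b a) (V a) (Z a)) :=
      h.mono fun a' h ↦ by simp [h]
    rw [covDerivAlong_congr g h, h.self_of_nhds, ← H hZ, mvfderiv_congr this]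
  · intro Z hZ
    simp [covDerivAlong_zero, mvfderiv_const]
  · intro V V' hV hV' h h' Z hZ
    have := mvfderiv_fun_add (hV.inner g hZ) (hV'.inner g hZ)
    simp only [Pi.add_apply, map_add, _root_.add_apply, this, h hZ, h' hZ,
      covDerivAlong_add g hV hV']
    ring
  intro h Y hh hY W hW
  have hY' := mdiffAlongAt_comp hb hY
  refine hW.induction (p := fun W ↦
    mvfderiv 𝓘(ℝ, EA) (fun a ↦ g.inner (b a) ((h • fun a ↦ Y (b a)) a) (W a)) a v =
      g.inner (b a) (covDerivAlong g b (h • fun a ↦ Y (b a)) a v) (W a) +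
        g.inner (b a) ((h • fun a ↦ Y (b a)) a) (covDerivAlong g b W a v)) ?_ ?_ ?_ ?_
  · intro V W h' hV H
    have : (fun a ↦ g.inner (b a) ((h • fun a ↦ Y (b a)) a) (W a)) =ᶠ[𝓝 a]
        (fun a ↦ g.inner (b a) ((h • fun a ↦ Y (b a)) a) (V a)) :=
      h'.mono fun a' h ↦ by simp [h]
    rw [covDerivAlong_congr g h', h'.self_of_nhds, ← H, mvfderiv_congr this]
  · simp [covDerivAlong_zero, mvfderiv_const]
  · intro V V' hV hV' H H'
    have := mvfderiv_fun_add ((hY'.smul hh).inner g hV) ((hY'.smul hh).inner g hV')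
    simp only [Pi.add_apply, map_add, this, _root_.add_apply, H, H',
      covDerivAlong_add g hV hV']
    ring
  intro k Z hk hZ
  -- For h·(Y ∘ b) and k·(Z ∘ b), the chain rule leaves only metric compatibility on `N` in the
  -- direction b_* v.
  have hZ' := mdiffAlongAt_comp hb hZ
  have h1 := mvfderiv_comp_apply a (mdifferentiableAt_metric g hY hZ) hb v
  have h2 := mvfderiv_fun_mul hh (hk.mul (hY'.inner g hZ'))
  have h3 := mvfderiv_fun_mul hk (hY'.inner g hZ')
  have h4 := leviCivita_metric g (FiberBundle.mdifferentiableAt_extend 𝓘(ℝ, E') E'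
    (mfderiv 𝓘(ℝ, EA) 𝓘(ℝ, E') b a v)) hY hZ
  simp only [FiberBundle.extend_apply_self] at h4
  have h5 : (fun a ↦ g.inner (b a) ((h • fun a ↦ Y (b a)) a) ((k • fun a ↦ Z (b a)) a)) =
      fun a ↦ h a * (k a * g.inner (b a) (Y (b a)) (Z (b a))) := by
    ext a'
    simp
    try ring
  rw [h5, covDerivAlong_smul g hh hY', covDerivAlong_smul g hk hZ', covDerivAlong_comp g hb hY,
    covDerivAlong_comp g hb hZ]
  simp only [Pi.mul_apply, Function.comp_def] at h1 h2 h3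
  erw [h2, h3]
  simp [h1, h4]
  ring

/-- A parallel tensor field commutes with the covariant derivative along `b`. -/
theorem covDerivAlong_parallel {P : Π y : N, TangentSpace 𝓘(ℝ, E') y →L[ℝ] TangentSpace 𝓘(ℝ, E') y}
    (hP : IsKahler g P) (hV : MDiffAlongAt EA b V a) (v : TangentSpace 𝓘(ℝ, EA) a) :
    MDiffAlongAt EA b (fun a ↦ P (b a) (V a)) a ∧
    covDerivAlong g b (fun a ↦ P (b a) (V a)) a v = P (b a) (covDerivAlong g b V a v) := by
  have hb := hV.base
  have hPV : ∀ {V}, MDiffAlongAt EA b V a → MDiffAlongAt EA b (fun a ↦ P (b a) (V a)) a :=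
    fun hV ↦ MDifferentiableAt.clm_bundle_apply (F₁ := E') (F₂ := E')
      (((hP.smooth (b a)).mdifferentiableAt (by simp)).comp a hV.base) hV
  refine ⟨hPV hV, ?_⟩
  refine hV.induction (p := fun V ↦ covDerivAlong g b (fun a ↦ P (b a) (V a)) a v =
    P (b a) (covDerivAlong g b V a v)) ?_ ?_ ?_ ?_
  · intro V W h hV H
    rw [covDerivAlong_congr g h, ← H]
    exact covDerivAlong_congr g (h.mono fun a' h ↦ by simp [h]) v
  · have := covDerivAlong_zero (EA := EA) g (b := b) (a := a) v
    rw [this, map_zero, ← this]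
    exact covDerivAlong_congr g (by simp) v
  · intro V W hV hW h h'
    rw [covDerivAlong_add g hV hW, map_add, ← h, ← h', ← covDerivAlong_add g (hPV hV) (hPV hW)]
    exact covDerivAlong_congr g (by simp) v
  · intro h Y hh hY
    have hPY : MDiffAt (T% (fun y ↦ P y (Y y))) (b a) :=
      MDifferentiableAt.clm_bundle_apply (F₁ := E') (F₂ := E')
      ((hP.smooth (b a)).mdifferentiableAt (by simp)) hY
    have hY' := mdiffAlongAt_comp hb hY
    rw [covDerivAlong_smul g hh hY', map_add, map_smul, map_smul, covDerivAlong_comp g hb hY,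
      ← hP.parallel Y _ hY, ← covDerivAlong_comp g hb hPY]
    refine (covDerivAlong_congr g (by simp) v).trans
      (covDerivAlong_smul g hh (hPV hY') v)

end Along

/-! ### Lie brackets in a chart, and commuting coordinate fields. -/

section Bracket

variable {E : Type*} [NormedAddCommGroup E] [NormedSpace ℝ E] [FiniteDimensional ℝ E]
  {M : Type*} [TopologicalSpace M] [ChartedSpace E M] [IsManifold 𝓘(ℝ, E) ∞ M]

/-- The vector field `Y` read in the chart at `q`. -/
def chartField (q : M) (Y : Π x : M, TangentSpace 𝓘(ℝ, E) x) : E → E :=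
  (fun p ↦ (mfderiv 𝓘(ℝ, E) 𝓘(ℝ, E) (extChartAt 𝓘(ℝ, E) q) p (Y p) : E)) ∘
    (extChartAt 𝓘(ℝ, E) q).symm

theorem chartField_extChartAt {q p : M} (hp : p ∈ (extChartAt 𝓘(ℝ, E) q).source)
    (Y : Π x : M, TangentSpace 𝓘(ℝ, E) x) :
    chartField q Y (extChartAt 𝓘(ℝ, E) q p) =
      mfderiv 𝓘(ℝ, E) 𝓘(ℝ, E) (extChartAt 𝓘(ℝ, E) q) p (Y p) := by
  exact congrArg (fun p ↦ (mfderiv 𝓘(ℝ, E) 𝓘(ℝ, E) (extChartAt 𝓘(ℝ, E) q) p (Y p) : E))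
    ((extChartAt 𝓘(ℝ, E) q).left_inv hp)

/-- The pullback by the inverse chart inverts the derivative of the inverse chart, and this inverse
is the derivative of the chart itself. -/
theorem mpullbackWithin_extChartAt_symm {q : M} {x : E} (hx : x ∈ (extChartAt 𝓘(ℝ, E) q).target)
    (Y : Π x : M, TangentSpace 𝓘(ℝ, E) x) :
    mpullbackWithin 𝓘(ℝ, E) 𝓘(ℝ, E) (extChartAt 𝓘(ℝ, E) q).symm Y (Set.range 𝓘(ℝ, E)) x =
      chartField q Y x := by
  rw [mpullbackWithin_apply, ContinuousLinearMap.inverse_eq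
    (mfderivWithin_extChartAt_symm_comp_mfderiv_extChartAt (I := 𝓘(ℝ, E)) hx)
    (mfderiv_extChartAt_comp_mfderivWithin_extChartAt_symm (I := 𝓘(ℝ, E)) hx)]
  rfl

theorem eventually_mpullbackWithin_extChartAt_symm (q : M) (Y : Π x : M, TangentSpace 𝓘(ℝ, E) x) :
    mpullbackWithin 𝓘(ℝ, E) 𝓘(ℝ, E) (extChartAt 𝓘(ℝ, E) q).symm Y (Set.range 𝓘(ℝ, E))
      =ᶠ[𝓝 (extChartAt 𝓘(ℝ, E) q q)] chartField q Y :=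
  Filter.eventuallyEq_of_mem (extChartAt_target_mem_nhds q) fun _ hx ↦ mpullbackWithin_extChartAt_symm hx Y

theorem contDiffAt_chart {φ : M → ℝ} {q : M} (hφ : ContMDiffAt 𝓘(ℝ, E) 𝓘(ℝ, ℝ) 2 φ q) :
    ContDiffAt ℝ 2 (φ ∘ (extChartAt 𝓘(ℝ, E) q).symm) (extChartAt 𝓘(ℝ, E) q q) := by
  have := (contMDiffAt_iff.1 hφ).2
  simpa only [modelWithCornersSelf_coe, Set.range_id, contDiffWithinAt_univ,
    extChartAt_model_space_eq_id, PartialEquiv.refl_coe, Function.id_comp] using this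

/-- The equality is needed on a neighbourhood, not just at `q`, because both sides are
differentiated again. -/
theorem mvfderiv_eventually_eq {φ : M → ℝ} {q : M} (hφ : ContMDiffAt 𝓘(ℝ, E) 𝓘(ℝ, ℝ) 2 φ q)
    (Y : Π x : M, TangentSpace 𝓘(ℝ, E) x) :
    ∀ᶠ p in 𝓝 q, mvfderiv 𝓘(ℝ, E) φ p (Y p) =
      fderiv ℝ (φ ∘ (extChartAt 𝓘(ℝ, E) q).symm) (extChartAt 𝓘(ℝ, E) q p)
        (chartField q Y (extChartAt 𝓘(ℝ, E) q p)) := by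
  have h2 := contDiffAt_chart hφ
  have h3 : ∀ᶠ x in 𝓝 (extChartAt 𝓘(ℝ, E) q q),
      DifferentiableAt ℝ (φ ∘ (extChartAt 𝓘(ℝ, E) q).symm) x :=
    (h2.eventually (by simp)).mono fun x hx ↦ hx.differentiableAt (by simp)
  filter_upwards [(continuousAt_extChartAt (I := 𝓘(ℝ, E)) q).eventually h3,
    eventually_eventually_nhds.2 (extChartAt_source_mem_nhds (I := 𝓘(ℝ, E)) q)] with p hp hs
  have hs' : p ∈ (extChartAt 𝓘(ℝ, E) q).source := hs.self_of_nhds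
  rw [chartField_extChartAt hs']
  have h4 := mvfderiv_comp_apply p hp.mdifferentiableAt (mdifferentiableAt_extChartAt (I := 𝓘(ℝ, E)) (by simpa using hs')) (Y p)
  have h5 : φ =ᶠ[𝓝 p] (φ ∘ (extChartAt 𝓘(ℝ, E) q).symm) ∘ (extChartAt 𝓘(ℝ, E) q) :=
    hs.mono fun p' hp' ↦ congrArg φ ((extChartAt 𝓘(ℝ, E) q).left_inv hp').symm
  rw [mvfderiv_congr h5, h4]
  simp [mvfderiv]
  rfl

theorem differentiableAt_chartField {q : M} {Y : Π x : M, TangentSpace 𝓘(ℝ, E) x}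
    (hY : MDiffAt (T% Y) q) :
    DifferentiableAt ℝ (chartField q Y) (extChartAt 𝓘(ℝ, E) q q) := by
  have : IsManifold 𝓘(ℝ, E) 2 M := IsManifold.of_le (n := ∞) (WithTop.coe_le_coe.2 le_top)
  have := MDifferentiableWithinAt.differentiableWithinAt_mpullbackWithin_vectorField
    (I := 𝓘(ℝ, E)) (V := Y) (s := Set.univ) (x := q) hY.mdifferentiableWithinAt
  simp only [Set.preimage_univ, Set.univ_inter, modelWithCornersSelf_coe, Set.range_id]
    at this
  refine (differentiableWithinAt_univ.1 this).congr_of_eventuallyEq ?_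
  simpa using (eventually_mpullbackWithin_extChartAt_symm q Y).symm

theorem mfderiv_extChartAt_mlieBracket (X Y : Π x : M, TangentSpace 𝓘(ℝ, E) x) (q : M) :
    mfderiv 𝓘(ℝ, E) 𝓘(ℝ, E) (extChartAt 𝓘(ℝ, E) q) q (mlieBracket 𝓘(ℝ, E) X Y q) =
      lieBracket ℝ (chartField q X) (chartField q Y) (extChartAt 𝓘(ℝ, E) q q) := by
  have h := (eventually_mpullbackWithin_extChartAt_symm q X).lieBracket_vectorField_eq (𝕜 := ℝ)
    (eventually_mpullbackWithin_extChartAt_symm q Y)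
  rw [← h]
  obtain ⟨L, hL⟩ := isInvertible_mfderiv_extChartAt (I := 𝓘(ℝ, E)) (mem_extChartAt_source q)
  rw [← mlieBracketWithin_univ, mlieBracketWithin_apply, ← hL, ContinuousLinearMap.inverse_equiv]
  simp only [Set.preimage_univ, Set.univ_inter, modelWithCornersSelf_coe, Set.range_id]
  refine (L.apply_symm_apply _).trans ?_
  exact congrFun (lieBracketWithin_univ (𝕜 := ℝ) (E := E)) _

/-- The Lie bracket is the commutator of derivations. -/
theorem mvfderiv_mlieBracket {φ : M → ℝ} {q : M} (hφ : ContMDiffAt 𝓘(ℝ, E) 𝓘(ℝ, ℝ) 2 φ q)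
    {X Y : Π x : M, TangentSpace 𝓘(ℝ, E) x} (hX : MDiffAt (T% X) q) (hY : MDiffAt (T% Y) q) :
    mvfderiv 𝓘(ℝ, E) φ q (mlieBracket 𝓘(ℝ, E) X Y q) =
      mvfderiv 𝓘(ℝ, E) (fun p ↦ mvfderiv 𝓘(ℝ, E) φ p (Y p)) q (X q) -
        mvfderiv 𝓘(ℝ, E) (fun p ↦ mvfderiv 𝓘(ℝ, E) φ p (X p)) q (Y q) := by
  set ψ := φ ∘ (extChartAt 𝓘(ℝ, E) q).symm with hψ
  set x₀ := extChartAt 𝓘(ℝ, E) q q with hx₀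
  have hs := mem_extChartAt_source (I := 𝓘(ℝ, E)) q
  have h2 : ContDiffAt ℝ 2 ψ x₀ := contDiffAt_chart hφ
  have h3 : DifferentiableAt ℝ (fderiv ℝ ψ) x₀ :=
    (h2.fderiv_right (m := 1) (by norm_num)).differentiableAt (by simp)
  -- The product rule in the chart. In X(Yφ) - Y(Xφ) the second derivatives of ψ cancel by symmetry,
  -- and Dψ applied to the bracket in the chart is left.
  have key : ∀ Y : Π x : M, TangentSpace 𝓘(ℝ, E) x, MDiffAt (T% Y) q → ∀ v,
      mvfderiv 𝓘(ℝ, E) (fun p ↦ mvfderiv 𝓘(ℝ, E) φ p (Y p)) q v =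
        fderiv ℝ (fderiv ℝ ψ) x₀ (mfderiv 𝓘(ℝ, E) 𝓘(ℝ, E) (extChartAt 𝓘(ℝ, E) q) q v)
          (chartField q Y x₀) + fderiv ℝ ψ x₀ (fderiv ℝ (chartField q Y) x₀
            (mfderiv 𝓘(ℝ, E) 𝓘(ℝ, E) (extChartAt 𝓘(ℝ, E) q) q v)) := by
    intro Y hY v
    rw [mvfderiv_congr (mvfderiv_eventually_eq hφ Y)]
    have h4 := h3.hasFDerivAt.clm_apply (differentiableAt_chartField hY).hasFDerivAt
    have h5 := mvfderiv_comp_apply q h4.differentiableAt.mdifferentiableAt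
      (mdifferentiableAt_extChartAt (I := 𝓘(ℝ, E)) (mem_chart_source E q)) v
    refine h5.trans ?_
    simp only [mvfderiv, mfderiv_eq_fderiv]
    erw [h4.fderiv]
    simp [add_comm]
    rfl
  rw [(mvfderiv_eventually_eq hφ _).self_of_nhds, key Y hY, key X hX, chartField_extChartAt hs,
    mfderiv_extChartAt_mlieBracket, ← chartField_extChartAt hs, ← chartField_extChartAt hs,
    lieBracket, map_sub]
  have h6 := h2.isSymmSndFDerivAt (by simp)
  have h7 := h6 (chartField q X x₀) (chartField q Y x₀)
  rw [← hx₀, h7]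
  abel

/-- This identifies the local frame of the trivialization with the coordinate vector fields of the
chart, so that frame coefficients can be computed as derivatives of coordinates. -/
theorem mfderiv_extChartAt_eq_trivialization {q p : M} (hp : p ∈ (chartAt E q).source)
    (v : TangentSpace 𝓘(ℝ, E) p) :
    (mfderiv 𝓘(ℝ, E) 𝓘(ℝ, E) (extChartAt 𝓘(ℝ, E) q) p v : E) =
      (tangentTriv (E' := E) q ⟨p, v⟩).2 :=
  (congrArg (fun L : TangentSpace 𝓘(ℝ, E) p →L[ℝ] E ↦ L v)
    (TangentBundle.continuousLinearMapAt_trivializationAt hp)).symm.trans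
    (Trivialization.continuousLinearMapAt_apply_of_mem (R := ℝ) _ (by exact hp) v)

theorem mvfderiv_continuousLinearMap (c : E →L[ℝ] ℝ) (x v : E) :
    mvfderiv 𝓘(ℝ, E) c x v = c v :=
  congrArg (fun L : E →L[ℝ] ℝ ↦ L v) ((mfderiv_eq_fderiv (f := c) (x := x)).trans c.fderiv)

theorem localFrameCoeff_eq_mfderiv {q p : M} (hp : p ∈ (chartAt E q).source)
    (v : TangentSpace 𝓘(ℝ, E) p) (i) :
    (tangentTriv (E' := E) q).localFrameCoeff 𝓘(ℝ, E) (Module.finBasis ℝ E) i p v =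
      (Module.finBasis ℝ E).coord i
        (mfderiv 𝓘(ℝ, E) 𝓘(ℝ, E) (extChartAt 𝓘(ℝ, E) q) p v : E) := by
  rw [localFrameCoeff_tangentTriv hp, mfderiv_extChartAt_eq_trivialization hp]
  rfl

theorem mfderiv_extChartAt_localFrame {q p : M} (hp : p ∈ (chartAt E q).source) (i) :
    (mfderiv 𝓘(ℝ, E) 𝓘(ℝ, E) (extChartAt 𝓘(ℝ, E) q) p
      ((tangentTriv (E' := E) q).localFrame (Module.finBasis ℝ E) i p) : E) =
      Module.finBasis ℝ E i := by
  rw [mfderiv_extChartAt_eq_trivialization hp,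
    Trivialization.localFrame_apply_of_mem_baseSet _ _ (by exact hp)]
  simp only [Trivialization.basisAt, Module.Basis.map_apply]
  exact ((tangentTriv (E' := E) q).linearEquivAt (R := ℝ) p hp).apply_symm_apply _

/-- Coordinate vector fields commute. -/
theorem mlieBracket_localFrame (q : M) (i j) :
    mlieBracket 𝓘(ℝ, E) ((tangentTriv (E' := E) q).localFrame (Module.finBasis ℝ E) i)
      ((tangentTriv (E' := E) q).localFrame (Module.finBasis ℝ E) j) q = 0 := by
  -- Read in the chart, the frame fields are constant near the base point.
  have h : ∀ i, chartField q ((tangentTriv (E' := E) q).localFrame (Module.finBasis ℝ E) i)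
      =ᶠ[𝓝 (extChartAt 𝓘(ℝ, E) q q)] fun _ ↦ Module.finBasis ℝ E i := fun i ↦
    Filter.eventuallyEq_of_mem (extChartAt_target_mem_nhds q) fun x hx ↦
      mfderiv_extChartAt_localFrame (by simpa using (extChartAt 𝓘(ℝ, E) q).map_target hx) i
  have h1 := mfderiv_extChartAt_mlieBracket
    ((tangentTriv (E' := E) q).localFrame (Module.finBasis ℝ E) i)
    ((tangentTriv (E' := E) q).localFrame (Module.finBasis ℝ E) j) q
  rw [(h i).lieBracket_vectorField_eq (h j)] at h1
  obtain ⟨L, hL⟩ := isInvertible_mfderiv_extChartAt (I := 𝓘(ℝ, E)) (mem_extChartAt_source q)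
  rw [← hL] at h1
  refine L.injective ?_
  rw [map_zero]
  refine Eq.trans h1 ?_
  simp [lieBracket]
  rfl

end Bracket

/-! ### The pullback connection is torsion-free. -/

section Torsion

variable {E : Type*} [NormedAddCommGroup E] [NormedSpace ℝ E] [FiniteDimensional ℝ E]
  {M : Type*} [TopologicalSpace M] [ChartedSpace E M] [IsManifold 𝓘(ℝ, E) ∞ M]
  {E' : Type*} [NormedAddCommGroup E'] [NormedSpace ℝ E'] [FiniteDimensional ℝ E']
  {N : Type*} [TopologicalSpace N] [ChartedSpace E' N] [IsManifold 𝓘(ℝ, E') ∞ N]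

/-- The pullback of the Levi-Civita connection is torsion-free. -/
theorem covDerivAlong_torsion (g : RMetric E' N) {F : M → N}
    (hF : ContMDiff 𝓘(ℝ, E) 𝓘(ℝ, E') ∞ F) {X Y : Π x : M, TangentSpace 𝓘(ℝ, E) x} {q : M}
    (hX : MDiffAt (T% X) q) (hY : MDiffAt (T% Y) q) :
    covDerivAlong g F (fun p ↦ mfderiv 𝓘(ℝ, E) 𝓘(ℝ, E') F p (Y p)) q (X q) -
      covDerivAlong g F (fun p ↦ mfderiv 𝓘(ℝ, E) 𝓘(ℝ, E') F p (X p)) q (Y q) =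
      mfderiv 𝓘(ℝ, E) 𝓘(ℝ, E') F q (mlieBracket 𝓘(ℝ, E) X Y q) := by
  have hmem := FiberBundle.mem_baseSet_trivializationAt' (F := E')
    (E := fun y : N ↦ TangentSpace 𝓘(ℝ, E') y) (F q)
  have hFd : ∀ p, MDifferentiableAt 𝓘(ℝ, E) 𝓘(ℝ, E') F p := hF.mdifferentiable (by simp)
  have hsrc : ∀ᶠ p in 𝓝 q, F p ∈ (chartAt E' (F q)).source :=
    hF.continuous.continuousAt.eventually (chart_source_mem_nhds E' (F q))
  let c := fun i : Fin (Module.finrank ℝ E') ↦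
    LinearMap.toContinuousLinearMap ((Module.finBasis ℝ E').coord i)
  -- The components of `F` in the chart at `F q`. The i-th coefficient of F_* Y is then Y φᵢ, so the
  -- derivative terms of the torsion are X(Yφᵢ) - Y(Xφᵢ) = [X, Y]φᵢ.
  let φ : Fin (Module.finrank ℝ E') → M → ℝ := fun i p ↦ c i (extChartAt 𝓘(ℝ, E') (F q) (F p))
  have hφ : ∀ i, ContMDiffAt 𝓘(ℝ, E) 𝓘(ℝ, ℝ) 2 (φ i) q := fun i ↦
    ((c i).contMDiff.contMDiffAt.comp (F q) (contMDiffAt_extChartAt (n := ∞))).comp q (hF q)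
      |>.of_le (WithTop.coe_le_coe.2 le_top)
  have hcoef : ∀ p, F p ∈ (chartAt E' (F q)).source → ∀ (v : TangentSpace 𝓘(ℝ, E) p) i,
      (tangentTriv (E' := E') (F q)).localFrameCoeff 𝓘(ℝ, E') (Module.finBasis ℝ E') i (F p)
        (mfderiv 𝓘(ℝ, E) 𝓘(ℝ, E') F p v) = mvfderiv 𝓘(ℝ, E) (φ i) p v := by
    intro p hp v i
    rw [localFrameCoeff_eq_mfderiv hp]
    have h1 := mvfderiv_comp_apply p (((c i).mdifferentiableAt (x := extChartAt 𝓘(ℝ, E') (F q) (F p))).comp (F p)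
      (mdifferentiableAt_extChartAt (I := 𝓘(ℝ, E')) hp)) (hFd p) v
    have h2 := mvfderiv_comp_apply (F p) ((c i).mdifferentiableAt (x := extChartAt 𝓘(ℝ, E') (F q) (F p)))
      (mdifferentiableAt_extChartAt (I := 𝓘(ℝ, E')) hp) (mfderiv 𝓘(ℝ, E) 𝓘(ℝ, E') F p v)
    rw [h2] at h1
    exact (h1.trans (mvfderiv_continuousLinearMap (c i) _ _)).symm
  have hd : ∀ X : Π x : M, TangentSpace 𝓘(ℝ, E) x, ∀ i, mvfderiv 𝓘(ℝ, E) (fun p ↦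
      (tangentTriv (E' := E') (F q)).localFrameCoeff 𝓘(ℝ, E') (Module.finBasis ℝ E') i (F p)
        (mfderiv 𝓘(ℝ, E) 𝓘(ℝ, E') F p (X p))) q =
      mvfderiv 𝓘(ℝ, E) (fun p ↦ mvfderiv 𝓘(ℝ, E) (φ i) p (X p)) q := fun X i ↦
    mvfderiv_congr (hsrc.mono fun p hp ↦ hcoef p hp (X p) i)
  have hq := hsrc.self_of_nhds
  have hsum := fun v : TangentSpace 𝓘(ℝ, E) q ↦
    sum_localFrameCoeff_tangentTriv hmem (mfderiv 𝓘(ℝ, E) 𝓘(ℝ, E') F q v)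
  simp only [hcoef q hq] at hsum
  -- Symmetry of the Christoffel symbols: ∇ on `N` is torsion-free and coordinate fields commute. It
  -- cancels the remaining terms, which are quadratic in F_*.
  have hsymm : ∀ i j, leviCivita g ((tangentTriv (E' := E') (F q)).localFrame
        (Module.finBasis ℝ E') i) (F q) ((tangentTriv (E' := E') (F q)).localFrame
        (Module.finBasis ℝ E') j (F q)) = leviCivita g ((tangentTriv (E' := E') (F q)).localFrame
        (Module.finBasis ℝ E') j) (F q) ((tangentTriv (E' := E') (F q)).localFrame
        (Module.finBasis ℝ E') i (F q)) := by
    intro i j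
    have := leviCivita_torsion g (mdifferentiableAt_localFrame hmem j)
      (mdifferentiableAt_localFrame hmem i)
    rwa [mlieBracket_localFrame, sub_eq_zero] at this
  have hexp : ∀ v w : TangentSpace 𝓘(ℝ, E) q, ∑ i, mvfderiv 𝓘(ℝ, E) (φ i) q v •
      leviCivita g ((tangentTriv (E' := E') (F q)).localFrame (Module.finBasis ℝ E') i) (F q)
        (mfderiv 𝓘(ℝ, E) 𝓘(ℝ, E') F q w) = ∑ i, ∑ j, (mvfderiv 𝓘(ℝ, E) (φ i) q v *
          mvfderiv 𝓘(ℝ, E) (φ j) q w) •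
      leviCivita g ((tangentTriv (E' := E') (F q)).localFrame (Module.finBasis ℝ E') i) (F q)
        ((tangentTriv (E' := E') (F q)).localFrame (Module.finBasis ℝ E') j (F q)) := by
    intro v w
    refine Finset.sum_congr rfl fun i _ ↦ ?_
    conv_lhs => rw [← hsum w]
    simp [Finset.smul_sum, mul_smul]
  rw [← hsum]
  simp only [covDerivAlong, hd, hcoef q hq, Finset.sum_add_distrib, hexp,
    mvfderiv_mlieBracket (hφ _) hX hY, sub_smul, Finset.sum_sub_distrib]
  have : ∑ i, ∑ j, (mvfderiv 𝓘(ℝ, E) (φ i) q (Y q) * mvfderiv 𝓘(ℝ, E) (φ j) q (X q)) •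
      leviCivita g ((tangentTriv (E' := E') (F q)).localFrame (Module.finBasis ℝ E') i) (F q)
        ((tangentTriv (E' := E') (F q)).localFrame (Module.finBasis ℝ E') j (F q)) =
      ∑ i, ∑ j, (mvfderiv 𝓘(ℝ, E) (φ i) q (X q) * mvfderiv 𝓘(ℝ, E) (φ j) q (Y q)) •
      leviCivita g ((tangentTriv (E' := E') (F q)).localFrame (Module.finBasis ℝ E') i) (F q)
        ((tangentTriv (E' := E') (F q)).localFrame (Module.finBasis ℝ E') j (F q)) := by
    rw [Finset.sum_comm]
    refine Finset.sum_congr rfl fun i _ ↦ Finset.sum_congr rfl fun j _ ↦ ?_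
    rw [hsymm j i, mul_comm]
  rw [this]
  abel

end Torsion

/-! ### Smoothness of inner products and of covariant derivatives. -/

section Smooth

variable {E : Type*} [NormedAddCommGroup E] [NormedSpace ℝ E] [FiniteDimensional ℝ E]
  {M : Type*} [TopologicalSpace M] [ChartedSpace E M] [IsManifold 𝓘(ℝ, E) ∞ M]
  {EA : Type*} [NormedAddCommGroup EA] [NormedSpace ℝ EA]
  {A : Type*} [TopologicalSpace A] [ChartedSpace EA A]
  (g : RMetric E M)

theorem contMDiffAt_inner {b : A → M} {V W : Π a : A, TangentSpace 𝓘(ℝ, E) (b a)} {a : A}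
    (hV : ContMDiffAt 𝓘(ℝ, EA) (𝓘(ℝ, E).prod 𝓘(ℝ, E)) ∞
      (fun a ↦ (⟨b a, V a⟩ : TangentBundle 𝓘(ℝ, E) M)) a)
    (hW : ContMDiffAt 𝓘(ℝ, EA) (𝓘(ℝ, E).prod 𝓘(ℝ, E)) ∞
      (fun a ↦ (⟨b a, W a⟩ : TangentBundle 𝓘(ℝ, E) M)) a) :
    ContMDiffAt 𝓘(ℝ, EA) 𝓘(ℝ, ℝ) ∞ (fun a ↦ g.inner (b a) (V a) (W a)) a := by
  have hb : ContMDiffAt 𝓘(ℝ, EA) 𝓘(ℝ, E) ∞ b a := (contMDiffAt_totalSpace.1 hV).1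
  have hg := (g.contMDiff (b a)).comp a hb
  have : ContMDiffAt 𝓘(ℝ, EA) (𝓘(ℝ, E).prod 𝓘(ℝ)) ∞
      (fun m ↦ TotalSpace.mk' ℝ (E := Bundle.Trivial M ℝ) (b m) (g.inner (b m) (V m) (W m))) a := by
    apply ContMDiffAt.clm_bundle_apply₂ (F₁ := E) (F₂ := E)
    · exact hg
    · exact hV
    · exact hW
  exact (contMDiffAt_totalSpace.1 this).2

theorem eq_zero_of_inner_localFrame {q p : M} (hp : p ∈ (tangentTriv (E' := E) q).baseSet)
    {v : TangentSpace 𝓘(ℝ, E) p} (h : ∀ i, g.inner p v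
      ((tangentTriv (E' := E) q).localFrame (Module.finBasis ℝ E) i p) = 0) : v = 0 := by
  by_contra hv
  refine (g.pos p v hv).ne' ?_
  conv_lhs => rw [← sum_localFrameCoeff_tangentTriv hp v]
  rw [sum_localFrameCoeff_tangentTriv hp v]
  conv_lhs => enter [2]; rw [← sum_localFrameCoeff_tangentTriv hp v]
  simp [h]

/-- The Gram matrix of the coordinate frame at `q`, as an endomorphism. -/
def gram (q p : M) : (Fin (Module.finrank ℝ E) → ℝ) →L[ℝ] (Fin (Module.finrank ℝ E) → ℝ) :=
  ∑ i, ∑ j, g.inner p ((tangentTriv (E' := E) q).localFrame (Module.finBasis ℝ E) j p)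
    ((tangentTriv (E' := E) q).localFrame (Module.finBasis ℝ E) i p) •
      (ContinuousLinearMap.single ℝ (fun _ ↦ ℝ) i ∘L ContinuousLinearMap.proj j)

theorem gram_apply (q p : M) (c : Fin (Module.finrank ℝ E) → ℝ) (i) : gram g q p c i =
    g.inner p (∑ j, c j • (tangentTriv (E' := E) q).localFrame (Module.finBasis ℝ E) j p)
      ((tangentTriv (E' := E) q).localFrame (Module.finBasis ℝ E) i p) := by
  simp [gram, Pi.single_apply, mul_comm]

/-- A combination of frame vectors orthogonal to the whole frame is zero, so the Gram matrix is
injective, hence bijective by finite dimension. -/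
theorem gram_isInvertible {q p : M} (hp : p ∈ (tangentTriv (E' := E) q).baseSet) :
    ∃ L : (Fin (Module.finrank ℝ E) → ℝ) ≃L[ℝ] (Fin (Module.finrank ℝ E) → ℝ),
      (L : (Fin (Module.finrank ℝ E) → ℝ) →L[ℝ] (Fin (Module.finrank ℝ E) → ℝ)) = gram g q p := by
  have hinj : Function.Injective (gram g q p).toLinearMap := by
    rw [← LinearMap.ker_eq_bot, LinearMap.ker_eq_bot']
    intro c hc
    have h0 := eq_zero_of_inner_localFrame g hp fun i ↦
      (gram_apply g q p c i).symm.trans (congrFun hc i)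
    have hli := ((tangentTriv (E' := E) q).isLocalFrameOn_localFrame_baseSet 𝓘(ℝ, E) 1
      (Module.finBasis ℝ E)).linearIndependent hp
    exact funext (Fintype.linearIndependent_iff.1 hli c h0)
  refine ⟨(LinearEquiv.ofInjectiveEndo _ hinj).toContinuousLinearEquiv, ?_⟩
  ext c i
  rfl

/-- A vector field is smooth if its inner products with the coordinate frame are. -/
theorem contMDiffAt_of_inner {X : Π x : M, TangentSpace 𝓘(ℝ, E) x} {q : M}
    (h : ∀ i, ContMDiffAt 𝓘(ℝ, E) 𝓘(ℝ, ℝ) ∞ (fun p ↦ g.inner p (X p)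
      ((tangentTriv (E' := E) q).localFrame (Module.finBasis ℝ E) i p)) q) :
    ContMDiffAt 𝓘(ℝ, E) (𝓘(ℝ, E).prod 𝓘(ℝ, E)) ∞
      (fun x ↦ (⟨x, X x⟩ : TangentBundle 𝓘(ℝ, E) M)) q := by
  have hq := FiberBundle.mem_baseSet_trivializationAt' (F := E)
    (E := fun y : M ↦ TangentSpace 𝓘(ℝ, E) y) q
  have hE : ∀ i, ContMDiffAt 𝓘(ℝ, E) (𝓘(ℝ, E).prod 𝓘(ℝ, E)) ∞ (fun x ↦ (⟨x,
      (tangentTriv (E' := E) q).localFrame (Module.finBasis ℝ E) i x⟩ : TangentBundle 𝓘(ℝ, E) M)) q :=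
    fun i ↦ contMDiffAt_localFrame_of_mem ∞ _ (Module.finBasis ℝ E) i hq
  refine (contMDiffAt_iff_localFrameCoeff (I := 𝓘(ℝ, E)) (Module.finBasis ℝ E) hq).2 fun i ↦ ?_
  have hG : ContMDiffAt 𝓘(ℝ, E) 𝓘(ℝ, (Fin (Module.finrank ℝ E) → ℝ) →L[ℝ]
      (Fin (Module.finrank ℝ E) → ℝ)) ∞ (gram g q) q := by
    unfold gram
    refine ContMDiffAt.sum fun i _ ↦ ContMDiffAt.sum fun j _ ↦ ?_
    exact (contMDiffAt_inner g (b := id) (hE j) (hE i)).smul contMDiffAt_const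
  obtain ⟨L, hL⟩ := gram_isInvertible g hq
  have hinv : ContDiffAt ℝ ∞ (ContinuousLinearMap.inverse : ((Fin (Module.finrank ℝ E) → ℝ) →L[ℝ]
      (Fin (Module.finrank ℝ E) → ℝ)) → _) (gram g q q) := hL ▸ contDiffAt_map_inverse L
  -- The coefficients of `X` are the inverse Gram matrix applied to its inner products with the
  -- frame, and inversion is smooth at an invertible operator.
  have hc := (hinv.contMDiffAt.comp q hG).clm_apply (contMDiffAt_pi_space.2 h)
  refine (contMDiffAt_pi_space.1 hc i).congr_of_eventuallyEq ?_
  filter_upwards [(tangentTriv (E' := E) q).open_baseSet.mem_nhds hq] with p hp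
  obtain ⟨K, hK⟩ := gram_isInvertible g hp
  have h1 : K (fun i ↦ (tangentTriv (E' := E) q).localFrameCoeff 𝓘(ℝ, E)
      (Module.finBasis ℝ E) i p (X p)) = fun i ↦ g.inner p (X p)
      ((tangentTriv (E' := E) q).localFrame (Module.finBasis ℝ E) i p) := by
    ext j
    have := gram_apply g q p (fun i ↦ (tangentTriv (E' := E) q).localFrameCoeff 𝓘(ℝ, E)
      (Module.finBasis ℝ E) i p (X p)) j
    rw [sum_localFrameCoeff_tangentTriv hp, ← hK] at this
    exact this
  simp only [Function.comp_apply, ← hK, ContinuousLinearMap.inverse_equiv]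
  rw [← h1]
  simp [LinearMap.piApply]

theorem contMDiffAt_mvfderiv_apply {φ : M → ℝ} {q : M} (hφ : ContMDiffAt 𝓘(ℝ, E) 𝓘(ℝ, ℝ) ∞ φ q)
    {Y : Π x : M, TangentSpace 𝓘(ℝ, E) x} (hY : ContMDiffAt 𝓘(ℝ, E) (𝓘(ℝ, E).prod 𝓘(ℝ, E)) ∞
      (fun x ↦ (⟨x, Y x⟩ : TangentBundle 𝓘(ℝ, E) M)) q) :
    ContMDiffAt 𝓘(ℝ, E) 𝓘(ℝ, ℝ) ∞ (fun p ↦ mvfderiv 𝓘(ℝ, E) φ p (Y p)) q := by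
  have h1 : ContDiffAt ℝ ∞ (fderiv ℝ (φ ∘ (extChartAt 𝓘(ℝ, E) q).symm)) (extChartAt 𝓘(ℝ, E) q q) := by
    have := (contMDiffAt_iff.1 hφ).2
    simp only [modelWithCornersSelf_coe, Set.range_id, contDiffWithinAt_univ,
      extChartAt_model_space_eq_id, PartialEquiv.refl_coe, Function.id_comp] at this
    exact this.fderiv_right (by simp)
  have h2 := (contMDiffAt_totalSpace.1 hY).2
  have h3 := h1.contMDiffAt.comp q (contMDiffAt_extChartAt (I := 𝓘(ℝ, E)) (n := ∞))
  refine (h3.clm_apply h2).congr_of_eventuallyEq ?_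
  filter_upwards [mvfderiv_eventually_eq (hφ.of_le (WithTop.coe_le_coe.2 le_top)) Y,
    extChartAt_source_mem_nhds (I := 𝓘(ℝ, E)) q] with p hp hs
  rw [hp, chartField_extChartAt hs, mfderiv_extChartAt_eq_trivialization (by simpa using hs)]
  rfl

/-- The covariant derivative of a smooth vector field along a smooth vector field is smooth. -/
theorem contMDiffAt_leviCivita {X Y : Π x : M, TangentSpace 𝓘(ℝ, E) x} {q : M}
    (hX : ContMDiffAt 𝓘(ℝ, E) (𝓘(ℝ, E).prod 𝓘(ℝ, E)) ∞
      (fun x ↦ (⟨x, X x⟩ : TangentBundle 𝓘(ℝ, E) M)) q)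
    (hY : ContMDiffAt 𝓘(ℝ, E) (𝓘(ℝ, E).prod 𝓘(ℝ, E)) ∞
      (fun x ↦ (⟨x, Y x⟩ : TangentBundle 𝓘(ℝ, E) M)) q)
    (hX' : ∀ᶠ p in 𝓝 q, MDiffAt (T% X) p) (hY' : ∀ᶠ p in 𝓝 q, MDiffAt (T% Y) p) :
    ContMDiffAt 𝓘(ℝ, E) (𝓘(ℝ, E).prod 𝓘(ℝ, E)) ∞
      (fun x ↦ (⟨x, leviCivita g Y x (X x)⟩ : TangentBundle 𝓘(ℝ, E) M)) q := by
  have hq := FiberBundle.mem_baseSet_trivializationAt' (F := E)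
    (E := fun y : M ↦ TangentSpace 𝓘(ℝ, E) y) q
  refine contMDiffAt_of_inner g fun i ↦ ?_
  set Z := (tangentTriv (E' := E) q).localFrame (Module.finBasis ℝ E) i
  have hZ : ContMDiffAt 𝓘(ℝ, E) (𝓘(ℝ, E).prod 𝓘(ℝ, E)) ∞
      (fun x ↦ (⟨x, Z x⟩ : TangentBundle 𝓘(ℝ, E) M)) q :=
    contMDiffAt_localFrame_of_mem ∞ _ (Module.finBasis ℝ E) i hq
  have hi : ∀ {X Y : Π x : M, TangentSpace 𝓘(ℝ, E) x}, ContMDiffAt 𝓘(ℝ, E) (𝓘(ℝ, E).prod 𝓘(ℝ, E)) ∞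
      (fun x ↦ (⟨x, X x⟩ : TangentBundle 𝓘(ℝ, E) M)) q → ContMDiffAt 𝓘(ℝ, E) (𝓘(ℝ, E).prod 𝓘(ℝ, E)) ∞
      (fun x ↦ (⟨x, Y x⟩ : TangentBundle 𝓘(ℝ, E) M)) q →
      ContMDiffAt 𝓘(ℝ, E) 𝓘(ℝ, ℝ) ∞ (fun p ↦ g.inner p (X p) (Y p)) q :=
    fun hX hY ↦ contMDiffAt_inner g (b := id) hX hY
  have hb : ∀ {X Y : Π x : M, TangentSpace 𝓘(ℝ, E) x}, ContMDiffAt 𝓘(ℝ, E) (𝓘(ℝ, E).prod 𝓘(ℝ, E)) ∞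
      (fun x ↦ (⟨x, X x⟩ : TangentBundle 𝓘(ℝ, E) M)) q → ContMDiffAt 𝓘(ℝ, E) (𝓘(ℝ, E).prod 𝓘(ℝ, E)) ∞
      (fun x ↦ (⟨x, Y x⟩ : TangentBundle 𝓘(ℝ, E) M)) q →
      ContMDiffAt 𝓘(ℝ, E) (𝓘(ℝ, E).prod 𝓘(ℝ, E)) ∞
      (fun x ↦ (⟨x, mlieBracket 𝓘(ℝ, E) X Y x⟩ : TangentBundle 𝓘(ℝ, E) M)) q := by
    intro X Y hX hY
    have : IsManifold 𝓘(ℝ, E) (((⊤ : ℕ∞) : WithTop ℕ∞) + 1) M := by simpa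
    have : IsManifold 𝓘(ℝ, E) (minSmoothness ℝ 2) M := by
      rw [minSmoothness_of_isRCLikeNormedField]
      exact IsManifold.of_le (n := ∞) (WithTop.coe_le_coe.2 le_top)
    exact ContMDiffAt.mlieBracket_vectorField (m := ⊤) (n := ⊤) hX hY (by simp)
  -- By Koszul's formula this function is g(∇_X Y, Z) near `q`; it is built from derivatives,
  -- brackets and inner products of smooth fields.
  have hk : ContMDiffAt 𝓘(ℝ, E) 𝓘(ℝ, ℝ) ∞ (fun p ↦ 2⁻¹ * koszul g X Y Z p) q := by
    unfold koszul
    exact contMDiffAt_const.mul (((((contMDiffAt_mvfderiv_apply (hi hY hZ) hX).add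
      (contMDiffAt_mvfderiv_apply (hi hX hZ) hY)).sub
      (contMDiffAt_mvfderiv_apply (hi hX hY) hZ)).add
      (hi (hb hX hY) hZ)).sub (hi (hb hX hZ) hY) |>.sub (hi (hb hY hZ) hX))
  refine hk.congr_of_eventuallyEq ?_
  filter_upwards [hX', hY', (tangentTriv (E' := E) q).open_baseSet.mem_nhds hq] with p hXp hYp hp
  rw [← leviCivitaFun_koszul g hXp hYp (mdifferentiableAt_localFrame hp i)]
  simp
  rfl

end Smooth

/-! ### Local existence of geodesics. -/

section Geodesic

variable {E : Type*} [NormedAddCommGroup E] [NormedSpace ℝ E] [FiniteDimensional ℝ E]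
  {M : Type*} [TopologicalSpace M] [ChartedSpace E M] [IsManifold 𝓘(ℝ, E) ∞ M]
  (g : RMetric E M)

/-- The vector `∇_{∂ⱼ} ∂ᵢ` at `p` for the chart at `q`, read in this chart. -/
def christoffel (q : M) (i j : Fin (Module.finrank ℝ E)) (p : M) : E :=
  (tangentTriv (E' := E) q ⟨p, leviCivita g
    ((tangentTriv (E' := E) q).localFrame (Module.finBasis ℝ E) i) p
    ((tangentTriv (E' := E) q).localFrame (Module.finBasis ℝ E) j p)⟩).2

theorem contMDiffAt_christoffel (q : M) (i j) :
    ContMDiffAt 𝓘(ℝ, E) 𝓘(ℝ, E) ∞ (christoffel g q i j) q := by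
  have hq := FiberBundle.mem_baseSet_trivializationAt' (F := E)
    (E := fun y : M ↦ TangentSpace 𝓘(ℝ, E) y) q
  have hE : ∀ i, ContMDiffAt 𝓘(ℝ, E) (𝓘(ℝ, E).prod 𝓘(ℝ, E)) ∞ (fun x ↦ (⟨x,
      (tangentTriv (E' := E) q).localFrame (Module.finBasis ℝ E) i x⟩ : TangentBundle 𝓘(ℝ, E) M)) q :=
    fun i ↦ contMDiffAt_localFrame_of_mem ∞ _ (Module.finBasis ℝ E) i hq
  have hE' : ∀ i, ∀ᶠ p in 𝓝 q, MDiffAt (T% ((tangentTriv (E' := E) q).localFrame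
      (Module.finBasis ℝ E) i)) p := fun i ↦
    Filter.eventually_of_mem ((tangentTriv (E' := E) q).open_baseSet.mem_nhds hq)
      fun p hp ↦ mdifferentiableAt_localFrame hp i
  exact (contMDiffAt_totalSpace.1 (contMDiffAt_leviCivita g (hE j) (hE i) (hE' j) (hE' i))).2

/-- The geodesic spray in the chart at `q`. -/
def spray (q : M) (z : E × E) : E × E :=
  (z.2, -∑ i, ∑ j, ((Module.finBasis ℝ E).coord i z.2 * (Module.finBasis ℝ E).coord j z.2) •
    christoffel g q i j ((extChartAt 𝓘(ℝ, E) q).symm z.1))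

theorem contDiffAt_spray (q : M) (u : E) :
    ContDiffAt ℝ 1 (spray g q) (extChartAt 𝓘(ℝ, E) q q, u) := by
  have hc : ∀ i (z : E × E), ContDiffAt ℝ 1 (fun z : E × E ↦ (Module.finBasis ℝ E).coord i z.2) z :=
    fun i z ↦ (LinearMap.toContinuousLinearMap ((Module.finBasis ℝ E).coord i)).contDiff.contDiffAt.comp z
      contDiffAt_snd
  have hC : ∀ i j, ContDiffAt ℝ 1 (fun z : E × E ↦
      christoffel g q i j ((extChartAt 𝓘(ℝ, E) q).symm z.1)) (extChartAt 𝓘(ℝ, E) q q, u) := by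
    intro i j
    have := (contMDiffAt_iff.1 (contMDiffAt_christoffel g q i j)).2
    simp only [modelWithCornersSelf_coe, Set.range_id, contDiffWithinAt_univ,
      extChartAt_model_space_eq_id, PartialEquiv.refl_coe, Function.id_comp] at this
    have h1 : ContDiffAt ℝ 1 (christoffel g q i j ∘ (extChartAt 𝓘(ℝ, E) q).symm)
        (extChartAt 𝓘(ℝ, E) q q) := this.of_le (WithTop.coe_le_coe.2 le_top)
    exact h1.comp (extChartAt 𝓘(ℝ, E) q q, u) (f := Prod.fst) contDiffAt_fst
  unfold spray
  refine contDiffAt_snd.prodMk (ContDiffAt.neg ?_)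
  exact ContDiffAt.sum fun i _ ↦ ContDiffAt.sum fun j _ ↦ ((hc i _).mul (hc j _)).smul (hC i j)

theorem exists_spray_integralCurve (q : M) (u : E) {W : Set M} (hW : W ∈ 𝓝 q) :
    ∃ α : ℝ → E × E, α 0 = (extChartAt 𝓘(ℝ, E) q q, u) ∧ ∃ δ > 0,
      ContDiffOn ℝ 2 α (Set.Ioo (-δ) δ) ∧ ∀ t ∈ Set.Ioo (-δ) δ,
        HasDerivAt α (spray g q (α t)) t ∧ (α t).1 ∈ (extChartAt 𝓘(ℝ, E) q).target ∧
          (extChartAt 𝓘(ℝ, E) q).symm (α t).1 ∈ W := by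
  obtain ⟨α, h0, ε, hε, hα⟩ :=
    (contDiffAt_spray g q u).exists_forall_mem_closedBall_exists_eq_forall_mem_Ioo_hasDerivAt₀ 0
  simp only [zero_sub, zero_add] at hα
  have hα0 : ContinuousAt α 0 := (hα 0 ⟨by linarith, hε⟩).continuousAt
  have h1 : ∀ᶠ t in 𝓝 0, ContDiffAt ℝ 1 (spray g q) (α t) := by
    refine hα0.eventually ?_
    rw [h0]
    exact (contDiffAt_spray g q u).eventually (by simp)
  have hfst : ContinuousAt (fun t ↦ (α t).1) 0 := continuous_fst.continuousAt.comp hα0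
  have h2 : ∀ᶠ t in 𝓝 0, (α t).1 ∈ (extChartAt 𝓘(ℝ, E) q).target := by
    refine hfst.eventually ?_
    simp only [h0]
    exact extChartAt_target_mem_nhds q
  have h3 : ∀ᶠ t in 𝓝 0, (extChartAt 𝓘(ℝ, E) q).symm (α t).1 ∈ W := by
    refine hfst.eventually (p := fun x ↦ (extChartAt 𝓘(ℝ, E) q).symm x ∈ W) ?_
    simp only [h0]
    refine (continuousAt_extChartAt_symm q).eventually ?_
    rwa [extChartAt_to_inv]
  obtain ⟨δ, hδ, H⟩ := Metric.eventually_nhds_iff.1 (h1.and (h2.and h3))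
  have hJ : ∀ t ∈ Set.Ioo (-min δ ε) (min δ ε), ContDiffAt ℝ 1 (spray g q) (α t) ∧
      HasDerivAt α (spray g q (α t)) t ∧ (α t).1 ∈ (extChartAt 𝓘(ℝ, E) q).target ∧
          (extChartAt 𝓘(ℝ, E) q).symm (α t).1 ∈ W := by
    intro t ht
    have h5 := H (y := t) (by
      rw [Real.dist_eq, sub_zero, abs_lt]
      exact ⟨by linarith [ht.1, min_le_left δ ε], ht.2.trans_le (min_le_left δ ε)⟩)
    exact ⟨h5.1, hα t ⟨by linarith [ht.1, min_le_right δ ε], ht.2.trans_le (min_le_right δ ε)⟩, h5.2⟩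
  refine ⟨α, h0, min δ ε, lt_min hδ hε, ?_, fun t ht ↦ (hJ t ht).2⟩
  have hdiff : DifferentiableOn ℝ α (Set.Ioo (-min δ ε) (min δ ε)) := fun t ht ↦
    (hJ t ht).2.1.differentiableAt.differentiableWithinAt
  have hder : ∀ t ∈ Set.Ioo (-min δ ε) (min δ ε), deriv α t = spray g q (α t) :=
    fun t ht ↦ (hJ t ht).2.1.deriv
  -- Bootstrapping: α' = spray ∘ α is as regular as α up to class C¹, so α gains one derivative at a
  -- time, from C⁰ to C¹ to C².
  have hn : ∀ n : WithTop ℕ∞, n ≤ 1 → n ≠ ∞ → ContDiffOn ℝ n α (Set.Ioo (-min δ ε) (min δ ε)) →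
      ContDiffOn ℝ n (deriv α) (Set.Ioo (-min δ ε) (min δ ε)) := by
    intro n hn _ h
    refine ContDiffOn.congr (fun t ht ↦ ?_) hder
    exact ((hJ t ht).1.of_le hn).comp_contDiffWithinAt t (h t ht)
  have hone : ContDiffOn ℝ 1 α (Set.Ioo (-min δ ε) (min δ ε)) := by
    rw [show (1 : WithTop ℕ∞) = 0 + 1 by simp, contDiffOn_succ_iff_deriv_of_isOpen isOpen_Ioo]
    exact ⟨hdiff, by simp, hn 0 (by simp) (by simp) (contDiffOn_zero.2 hdiff.continuousOn)⟩
  rw [show (2 : WithTop ℕ∞) = 1 + 1 by norm_num, contDiffOn_succ_iff_deriv_of_isOpen isOpen_Ioo]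
  exact ⟨hdiff, by simp, hn 1 le_rfl (by simp) hone⟩

/-- Local existence of geodesics. -/
theorem exists_geodesic (q : M) (v : TangentSpace 𝓘(ℝ, E) q) {W : Set M} (hW : W ∈ 𝓝 q) :
    ∃ β : ℝ → M, (⟨β 0, velocity (E' := E) β 0⟩ : TangentBundle 𝓘(ℝ, E) M) = ⟨q, v⟩ ∧ ∃ δ > 0,
      IsGeodesicOn g β (Set.Ioo (-δ) δ) ∧ (∀ t ∈ Set.Ioo (-δ) δ, β t ∈ W) ∧
      ∀ t ∈ Set.Ioo (-δ) δ, MDiffAlongAt ℝ β (velocity (E' := E) β) t := by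
  obtain ⟨α, h0, δ, hδ, h2, hα⟩ := exists_spray_integralCurve g q
    (mfderiv 𝓘(ℝ, E) 𝓘(ℝ, E) (extChartAt 𝓘(ℝ, E) q) q v : E) hW
  set J := Set.Ioo (-δ) δ
  have h0J : (0 : ℝ) ∈ J := ⟨by linarith, hδ⟩
  let β : ℝ → M := fun t ↦ (extChartAt 𝓘(ℝ, E) q).symm (α t).1
  have hβ : ContMDiffOn 𝓘(ℝ, ℝ) 𝓘(ℝ, E) 2 β J := by
    have := contMDiffOn_extChartAt_symm (I := 𝓘(ℝ, E)) (n := ∞) q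
    exact (this.of_le (WithTop.coe_le_coe.2 le_top)).comp (contDiff_fst.comp_contDiffOn h2).contMDiffOn
      fun t ht ↦ (hα t ht).2.1
  have hβd : ∀ t ∈ J, MDifferentiableAt 𝓘(ℝ, ℝ) 𝓘(ℝ, E) β t := fun t ht ↦
    ((hβ t ht).contMDiffAt (isOpen_Ioo.mem_nhds ht)).mdifferentiableAt (by simp)
  have hβs : ∀ t ∈ J, β t ∈ (chartAt E q).source := fun t ht ↦ by
    simpa [β] using (extChartAt 𝓘(ℝ, E) q).map_target (hα t ht).2.1
  have hx : ∀ t ∈ J, HasDerivAt (fun t ↦ (α t).1) (α t).2 t := fun t ht ↦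
    (hasFDerivAt_fst (p := α t)).comp_hasDerivAt t (hα t ht).1
  have hvel : ∀ t ∈ J, (mfderiv 𝓘(ℝ, E) 𝓘(ℝ, E) (extChartAt 𝓘(ℝ, E) q) (β t)
      (velocity (E' := E) β t) : E) = (α t).2 := by
    intro t ht
    have h1 := mfderiv_comp_apply t (mdifferentiableAt_extChartAt (I := 𝓘(ℝ, E)) (hβs t ht))
      (hβd t ht) (1 : ℝ)
    have h3 : (extChartAt 𝓘(ℝ, E) q) ∘ β =ᶠ[𝓝 t] fun t ↦ (α t).1 :=
      Filter.eventuallyEq_of_mem (isOpen_Ioo.mem_nhds ht)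
        fun s hs ↦ (extChartAt 𝓘(ℝ, E) q).right_inv (hα s hs).2.1
    refine h1.symm.trans ?_
    rw [h3.mfderiv_eq, mfderiv_eq_fderiv]
    exact (hx t ht).deriv
  have hcoef : ∀ t ∈ J, ∀ i, (tangentTriv (E' := E) q).localFrameCoeff 𝓘(ℝ, E)
      (Module.finBasis ℝ E) i (β t) (velocity (E' := E) β t) =
      (Module.finBasis ℝ E).coord i (α t).2 := fun t ht i ↦ by
    rw [localFrameCoeff_eq_mfderiv (hβs t ht), hvel t ht]
  have hsum : ∀ t ∈ J, velocity (E' := E) β t = ∑ i, (Module.finBasis ℝ E).coord i (α t).2 •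
      (tangentTriv (E' := E) q).localFrame (Module.finBasis ℝ E) i (β t) := fun t ht ↦ by
    rw [← sum_localFrameCoeff_tangentTriv (hβs t ht) (velocity (E' := E) β t)]
    simp only [hcoef t ht]
  have hsum' : ∀ t ∈ J, ∀ᶠ s in 𝓝 t, velocity (E' := E) β s = (∑ i,
      (fun s ↦ (Module.finBasis ℝ E).coord i (α s).2) • (fun s ↦
      (tangentTriv (E' := E) q).localFrame (Module.finBasis ℝ E) i (β s)) :
        Π s, TangentSpace 𝓘(ℝ, E) (β s)) s := fun t ht ↦
    Filter.eventually_of_mem (isOpen_Ioo.mem_nhds ht) fun s hs ↦ by simp [hsum s hs]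
  have hu : ∀ t ∈ J, ∀ i, HasDerivAt (fun s ↦ (Module.finBasis ℝ E).coord i (α s).2)
      ((Module.finBasis ℝ E).coord i (spray g q (α t)).2) t := fun t ht i ↦
    ((LinearMap.toContinuousLinearMap ((Module.finBasis ℝ E).coord i)).hasFDerivAt.comp_hasDerivAt t
      (hasFDerivAt_snd.comp_hasDerivAt t (hα t ht).1) :)
  have hum : ∀ t ∈ J, ∀ i, MDifferentiableAt 𝓘(ℝ, ℝ) 𝓘(ℝ, ℝ)
      (fun s ↦ (Module.finBasis ℝ E).coord i (α s).2) t := fun t ht i ↦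
    (hu t ht i).differentiableAt.mdifferentiableAt
  have hEd : ∀ t ∈ J, ∀ i, MDiffAlongAt ℝ β (fun s ↦
      (tangentTriv (E' := E) q).localFrame (Module.finBasis ℝ E) i (β s)) t := fun t ht i ↦
    mdiffAlongAt_comp (hβd t ht) (mdifferentiableAt_localFrame (hβs t ht) i)
  have hterm : ∀ t ∈ J, ∀ i, MDiffAlongAt ℝ β ((fun s ↦ (Module.finBasis ℝ E).coord i (α s).2) •
      (fun s ↦ (tangentTriv (E' := E) q).localFrame (Module.finBasis ℝ E) i (β s))) t :=
    fun t ht i ↦ (hEd t ht i).smul (hum t ht i)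
  have hβ0 : β 0 = q := by simp only [β, h0, extChartAt_to_inv]
  refine ⟨β, ?_, δ, hδ, ⟨hβ, fun t ht ↦ ?_⟩, fun t ht ↦ (hα t ht).2.2, fun t ht ↦
    (MDiffAlongAt.sum _ (hβd t ht) fun i _ ↦ hterm t ht i).congr (hsum' t ht)⟩
  -- The base points `β 0` and `q` are not definitionally equal, so the two tangent vectors are
  -- compared inside the trivialization at `q`.
  · refine (tangentTriv (E' := E) q).injOn ?_ ?_ ?_
    · exact (tangentTriv (E' := E) q).mem_source.2 (hβs 0 h0J)
    · exact (tangentTriv (E' := E) q).mem_source.2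
        (FiberBundle.mem_baseSet_trivializationAt' (F := E) q)
    · refine Prod.ext hβ0 ?_
      refine (mfderiv_extChartAt_eq_trivialization (hβs 0 h0J) _).symm.trans
        (Eq.trans ?_ (mfderiv_extChartAt_eq_trivialization (mem_chart_source E q) v))
      rw [hvel 0 h0J, h0]
  · have hlin := (tangentTriv (E' := E) q).linear ℝ (hβs t ht)
    -- The acceleration is the second-derivative term plus this quadratic Christoffel term. Expanded
    -- in the frame, the latter has as coefficients the negatives of those of the second component
    -- of the spray, so the two cancel.
    have hZ := sum_localFrameCoeff_tangentTriv (hβs t ht) (∑ i, ∑ j,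
      ((Module.finBasis ℝ E).coord i (α t).2 * (Module.finBasis ℝ E).coord j (α t).2) •
        leviCivita g ((tangentTriv (E' := E) q).localFrame (Module.finBasis ℝ E) i) (β t)
          ((tangentTriv (E' := E) q).localFrame (Module.finBasis ℝ E) j (β t)))
    have hcd : ∀ i, covDerivAlong (EA := ℝ) g β ((fun s ↦ (Module.finBasis ℝ E).coord i (α s).2) •
        (fun s ↦ (tangentTriv (E' := E) q).localFrame (Module.finBasis ℝ E) i (β s))) t (1 : ℝ) =
        (Module.finBasis ℝ E).coord i (spray g q (α t)).2 •
          (tangentTriv (E' := E) q).localFrame (Module.finBasis ℝ E) i (β t) +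
        ∑ j, ((Module.finBasis ℝ E).coord i (α t).2 * (Module.finBasis ℝ E).coord j (α t).2) •
        leviCivita g ((tangentTriv (E' := E) q).localFrame (Module.finBasis ℝ E) i) (β t)
          ((tangentTriv (E' := E) q).localFrame (Module.finBasis ℝ E) j (β t)) := by
      intro i
      refine (covDerivAlong_smul g (hum t ht i) (hEd t ht i) (1 : ℝ)).trans
        (congrArg₂ (· + ·) ?_ ?_)
      · refine congrArg (· • (tangentTriv (E' := E) q).localFrame (Module.finBasis ℝ E) i (β t)) ?_
        exact (congrArg (fun L : ℝ →L[ℝ] ℝ ↦ L 1) mfderiv_eq_fderiv).trans (hu t ht i).deriv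
      · refine (congrArg ((Module.finBasis ℝ E).coord i (α t).2 • ·) (covDerivAlong_comp g (hβd t ht)
          (mdifferentiableAt_localFrame (hβs t ht) i) (1 : ℝ))).trans ?_
        change _ • leviCivita g _ (β t) (velocity (E' := E) β t) = _
        rw [hsum t ht]
        simp [Finset.smul_sum, mul_smul]
    refine (covDerivAlong_congr g (hsum' t ht) (1 : ℝ)).trans ((covDerivAlong_sum g _ (hβd t ht)
      (fun i _ ↦ hterm t ht i) (1 : ℝ)).trans ((Finset.sum_congr rfl fun i _ ↦ hcd i).trans ?_))
    rw [Finset.sum_add_distrib, ← hZ, ← Finset.sum_add_distrib]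
    refine Finset.sum_eq_zero fun i _ ↦ ?_
    rw [← add_smul]
    convert zero_smul ℝ _
    have h5 : (tangentTriv (E' := E) q ⟨β t, ∑ i, ∑ j,
        ((Module.finBasis ℝ E).coord i (α t).2 * (Module.finBasis ℝ E).coord j (α t).2) •
        leviCivita g ((tangentTriv (E' := E) q).localFrame (Module.finBasis ℝ E) i) (β t)
          ((tangentTriv (E' := E) q).localFrame (Module.finBasis ℝ E) j (β t))⟩).2 =
        -(spray g q (α t)).2 := by
      refine (map_sum hlin.mk' _ _).trans ?_
      simp only [spray, neg_neg, map_sum, map_smul]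
      rfl
    rw [localFrameCoeff_tangentTriv (hβs t ht), h5]
    simp

end Geodesic

/-! ### Orthogonal complements in a tangent space. -/

section Perp

variable {E : Type*} [NormedAddCommGroup E] [NormedSpace ℝ E] [FiniteDimensional ℝ E]
  {M : Type*} [TopologicalSpace M] [ChartedSpace E M] [IsManifold 𝓘(ℝ, E) ∞ M]
  (g : RMetric E M) {x : M} {S : Submodule ℝ (TangentSpace 𝓘(ℝ, E) x)}

theorem mem_perp {v : TangentSpace 𝓘(ℝ, E) x} : v ∈ perp g S ↔ ∀ w ∈ S, g.inner x w v = 0 :=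
  Iff.rfl

theorem inner_self_nonneg (v : TangentSpace 𝓘(ℝ, E) x) : 0 ≤ g.inner x v v := by
  rcases eq_or_ne v 0 with rfl | h
  · simp
  · exact (g.pos x v h).le

theorem inner_self_eq_zero {v : TangentSpace 𝓘(ℝ, E) x} (h : g.inner x v v = 0) : v = 0 := by
  by_contra hv
  exact (g.pos x v hv).ne' h

theorem exists_mem_perp_sub_mem (S : Submodule ℝ (TangentSpace 𝓘(ℝ, E) x))
    (v : TangentSpace 𝓘(ℝ, E) x) : ∃ V ∈ perp g S, v - V ∈ S := by
  have hrefl : (bilin g x).IsRefl := fun v w h ↦ (g.symm x w v).trans h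
  have hnd : ((bilin g x).restrict S).Nondegenerate := by
    constructor
    · intro v hv
      exact Subtype.ext (inner_self_eq_zero g (hv v))
    · intro v hv
      exact Subtype.ext (inner_self_eq_zero g (hv v))
  have hc := LinearMap.BilinForm.isCompl_orthogonal_of_restrict_nondegenerate hrefl hnd
  obtain ⟨w, hw, V, hV, rfl⟩ := Submodule.mem_sup.1 (hc.sup_eq_top ▸ Submodule.mem_top : v ∈ S ⊔ _)
  exact ⟨V, hV, by simpa using hw⟩

end Perp

/-! ### What the Clairaut relation says about the distribution on the target. -/

section Clairaut

variable {E : Type*} [NormedAddCommGroup E] [NormedSpace ℝ E] [FiniteDimensional ℝ E]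
  {M : Type*} [TopologicalSpace M] [ChartedSpace E M] [IsManifold 𝓘(ℝ, E) ∞ M]
  (g : RMetric E M)

theorem hasDerivAt_mvfderiv {h : ℝ → ℝ} {t : ℝ} (hh : MDifferentiableAt 𝓘(ℝ, ℝ) 𝓘(ℝ, ℝ) h t) :
    HasDerivAt h (mvfderiv 𝓘(ℝ, ℝ) h t (1 : ℝ)) t := by
  have e : mvfderiv 𝓘(ℝ, ℝ) h t (1 : ℝ) = deriv h t :=
    congrArg (fun L : ℝ →L[ℝ] ℝ ↦ L 1) mfderiv_eq_fderiv
  rw [e]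
  exact hh.differentiableAt.hasDerivAt

/-- Pythagoras: cos θ = |V| / |v| because v - V is orthogonal to V. -/
theorem sin_angle_sq {x : M} {S : Submodule ℝ (TangentSpace 𝓘(ℝ, E) x)}
    {v V : TangentSpace 𝓘(ℝ, E) x} (hv : v ≠ 0) (hV : V ∈ perp g S) (hvV : v - V ∈ S) :
    Real.sin (angle g v V) ^ 2 * g.inner x v v = g.inner x v v - g.inner x V V := by
  have h1 := (mem_perp g).1 hV _ hvV
  have h2 : g.inner x v V = g.inner x V V := by
    simp only [map_sub, _root_.sub_apply] at h1
    linarith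
  have hA := g.pos x v hv
  have hB := inner_self_nonneg g V
  have hBA : g.inner x V V ≤ g.inner x v v := by
    have := inner_self_nonneg g (v - V)
    have h3 := g.symm x v V
    simp only [map_sub, _root_.sub_apply] at this
    linarith
  have hcos : (g.inner x V V / (√(g.inner x v v) * √(g.inner x V V))) ^ 2 =
      g.inner x V V / g.inner x v v := by
    rw [div_pow, mul_pow, Real.sq_sqrt hA.le, Real.sq_sqrt hB]
    -- For V = 0 the quotient is 0 by the convention on division, which matches an angle of π/2.
    rcases hB.eq_or_lt with h | h
    · simp [← h]
    · field_simp
  rw [angle, h2, Real.sin_arccos, Real.sq_sqrt, hcos]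
  · field_simp
  · rw [hcos, sub_nonneg]
    exact div_le_one_of_le₀ hBA hA.le

/-- This is the derivative at 0 of |β'|² - |V|² = c² e^{-2f} |β'|² along the geodesic with initial
velocity `Z y + n`. Differentiability of the normal component V need not be known: |β' - Z|² ≥ |V|²,
with equality at 0, so |β' - Z|² can replace |V|² and a vanishing derivative comes from a minimum.
-/
theorem clairaut_derivative {f : M → ℝ} {W : Set M}
    {R : Π y : M, Submodule ℝ (TangentSpace 𝓘(ℝ, E) y)} (hW : IsOpen W)
    (hR : ∀ (β : ℝ → M) (J : Set ℝ), IsOpen J → J.OrdConnected → (∀ t ∈ J, β t ∈ W) →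
      IsGeodesicOn g β J →
      ∃ c : ℝ, ∀ t ∈ J, ∀ V ∈ perp g (R (β t)), velocity (E' := E) β t - V ∈ R (β t) →
        Real.exp (f (β t)) * Real.sin (angle g (velocity (E' := E) β t) V) = c)
    {y : M} (hy : y ∈ W) (hf : MDifferentiableAt 𝓘(ℝ, E) 𝓘(ℝ, ℝ) f y)
    {Z : Π y : M, TangentSpace 𝓘(ℝ, E) y} (hZ : MDiffAt (T% Z) y) (hZR : ∀ᶠ z in 𝓝 y, Z z ∈ R z)
    {n : TangentSpace 𝓘(ℝ, E) y} (hn : n ∈ perp g (R y)) :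
    mvfderiv 𝓘(ℝ, E) f y (Z y + n) * g.inner y (Z y) (Z y) +
      g.inner y (leviCivita g Z y (Z y + n)) n = 0 := by
  rcases eq_or_ne (Z y + n) 0 with h0 | h0
  · simp [h0]
  obtain ⟨β, hβ0, δ, hδ, hgeo, hβW, hvel⟩ := exists_geodesic g y (Z y + n) (hW.mem_nhds hy)
  obtain ⟨hb, hv⟩ := TotalSpace.mk.inj hβ0
  subst hb
  have hv := eq_of_heq hv
  have h0J : (0 : ℝ) ∈ Set.Ioo (-δ) δ := ⟨by linarith, hδ⟩
  obtain ⟨c, hc⟩ := hR β _ isOpen_Ioo Set.ordConnected_Ioo hβW hgeo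
  have hvel0 := hvel 0 h0J
  have hb := hvel0.base
  have hZβ := mdiffAlongAt_comp hb hZ
  have hneg : MDiffAlongAt ℝ β (fun t ↦ -Z (β t)) 0 :=
    (hZβ.smul (h := fun _ ↦ (-1 : ℝ)) mdifferentiableAt_const).congr (by simp)
  have hU : MDiffAlongAt ℝ β (velocity (E' := E) β + fun t ↦ -Z (β t)) 0 := hvel0.add hneg
  have hUd : covDerivAlong g β (velocity (E' := E) β + fun t ↦ -Z (β t)) 0 (1 : ℝ) =
      -leviCivita g Z (β 0) (Z (β 0) + n) := by
    refine (covDerivAlong_add g hvel0 hneg (1 : ℝ)).trans ?_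
    rw [hgeo.2 0 h0J, zero_add]
    refine (covDerivAlong_congr g (W := (fun _ ↦ (-1 : ℝ)) • fun t ↦ Z (β t)) (by simp) (1 : ℝ)).trans
      ((covDerivAlong_smul g mdifferentiableAt_const hZβ (1 : ℝ)).trans ?_)
    rw [mvfderiv_const]
    refine Eq.trans (congrArg₂ (· + ·) (zero_smul ℝ (Z (β 0))) (congrArg ((-1 : ℝ) • ·)
      (covDerivAlong_comp g hb hZ (1 : ℝ)))) ?_
    change 0 + (-1 : ℝ) • leviCivita g Z (β 0) (velocity (E' := E) β 0) = _
    rw [hv]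
    simp [add_comm]
  have hU0 : (velocity (E' := E) β + fun t ↦ -Z (β t)) 0 = n := by
    simp [hv]
  have hA := hasDerivAt_mvfderiv (hvel0.inner g hvel0)
  have hAd := covDerivAlong_metric g hvel0 hvel0 (1 : ℝ)
  rw [hgeo.2 0 h0J] at hAd
  simp only [map_zero, _root_.zero_apply, add_zero] at hAd
  have hD := hasDerivAt_mvfderiv (hU.inner g hU)
  have hDd := covDerivAlong_metric g hU hU (1 : ℝ)
  rw [hUd, hU0, g.symm _ n] at hDd
  have hfβ := hasDerivAt_mvfderiv (hf.comp (0 : ℝ) hb)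
  have hfd : mvfderiv 𝓘(ℝ, ℝ) (f ∘ β) 0 (1 : ℝ) = mvfderiv 𝓘(ℝ, E) f (β 0) (Z (β 0) + n) := by
    rw [← hv]
    exact mvfderiv_comp_apply (0 : ℝ) hf hb (1 : ℝ)
  rw [hAd] at hA
  rw [hDd] at hD
  rw [hfd] at hfβ
  have hexp := ((hfβ.const_mul (-2)).exp.const_mul (c ^ 2)).mul hA
  have hk := (hD.sub hA).add hexp
  -- `sin_angle_sq` needs a nonzero velocity; this persists near 0 by continuity of |β'|².
  have hpt : ∀ᶠ t in 𝓝 (0 : ℝ), t ∈ Set.Ioo (-δ) δ ∧ velocity (E' := E) β t ≠ 0 ∧ Z (β t) ∈ R (β t) := by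
    refine (isOpen_Ioo.mem_nhds h0J |> fun h ↦ Filter.eventually_of_mem h fun t ht ↦ ht).and
      (Filter.Eventually.and ?_ (hb.continuousAt.eventually hZR))
    have hpos : 0 < g.inner (β 0) (velocity (E' := E) β 0) (velocity (E' := E) β 0) := by
      rw [hv]; exact g.pos _ _ h0
    refine (hA.continuousAt.eventually (lt_mem_nhds hpos)).mono fun t ht h ↦ ?_
    rw [h] at ht
    simp at ht
  have key : ∀ t ∈ Set.Ioo (-δ) δ, velocity (E' := E) β t ≠ 0 → ∀ V ∈ perp g (R (β t)),
      velocity (E' := E) β t - V ∈ R (β t) →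
      c ^ 2 * Real.exp (-2 * f (β t)) * g.inner (β t) (velocity (E' := E) β t)
        (velocity (E' := E) β t) = g.inner (β t) (velocity (E' := E) β t)
        (velocity (E' := E) β t) - g.inner (β t) V V := by
    intro t ht hne V hV hVR
    rw [← sin_angle_sq g hne hV hVR, ← hc t ht V hV hVR, mul_pow, ← Real.exp_nat_mul]
    have : Real.exp ((2 : ℕ) * f (β t)) * Real.exp (-2 * f (β t)) = 1 := by
      rw [← Real.exp_add]
      simp
    linear_combination (Real.sin (angle g (velocity (E' := E) β t) V) ^ 2 *
      g.inner (β t) (velocity (E' := E) β t) (velocity (E' := E) β t)) * this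
  have hZn : g.inner (β 0) (Z (β 0)) n = 0 := hn _ hZR.self_of_nhds
  have hkey0 := key 0 h0J (by rw [hv]; exact h0) n hn (by rw [hv]; simpa using hZR.self_of_nhds)
  have hnZ := g.symm (β 0) (Z (β 0)) n
  -- By `key` this function is |β' - Z|² - |V|². As β' - V and Z both lie in R, it equals |β' - V -
  -- Z|² ≥ 0, and it vanishes at 0, where β' - Z = n = V.
  have hmin : IsLocalMin (fun t ↦ g.inner (β t) ((velocity (E' := E) β + fun t ↦ -Z (β t)) t)
      ((velocity (E' := E) β + fun t ↦ -Z (β t)) t) -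
      g.inner (β t) (velocity (E' := E) β t) (velocity (E' := E) β t) +
      c ^ 2 * Real.exp (-2 * f (β t)) * g.inner (β t) (velocity (E' := E) β t)
        (velocity (E' := E) β t)) 0 := by
    refine hpt.mono fun t ⟨ht, hne, hZt⟩ ↦ ?_
    obtain ⟨V, hV, hVR⟩ := exists_mem_perp_sub_mem g (R (β t)) (velocity (E' := E) β t)
    have h1 := key t ht hne V hV hVR
    have h2 : g.inner (β t) (velocity (E' := E) β t - V - Z (β t)) V = 0 :=
      hV _ ((R (β t)).sub_mem hVR hZt)
    have h3 := inner_self_nonneg g (velocity (E' := E) β t - V - Z (β t))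
    have h4 : (velocity (E' := E) β + fun t ↦ -Z (β t)) t =
        (velocity (E' := E) β t - V - Z (β t)) + V := by
      simp only [Pi.add_apply]
      abel
    have h5 := g.symm (β t) V (velocity (E' := E) β t - V - Z (β t))
    simp only [hU0]
    rw [h4]
    generalize velocity (E' := E) β t - V - Z (β t) = T at h2 h3 h5 ⊢
    simp only [map_add, _root_.add_apply]
    linarith
  have hzero := hmin.hasDerivAt_eq_zero hk
  -- At 0 the tangential part of β' is Z, so Clairaut's relation reads c² e^{-2f} |β'|² = |Z|²; this
  -- eliminates the constant c.
  have hcc : c ^ 2 * Real.exp (-2 * f (β 0)) * g.inner (β 0) (velocity (E' := E) β 0)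
        (velocity (E' := E) β 0) = g.inner (β 0) (Z (β 0)) (Z (β 0)) := by
    rw [hkey0, hv]
    simp only [map_add, _root_.add_apply]
    linarith
  simp only [map_neg, _root_.neg_apply, mul_zero, add_zero, sub_zero, Function.comp_apply] at hzero
  linear_combination (-1 / 2) * hzero - mvfderiv 𝓘(ℝ, E) f (β 0) (Z (β 0) + n) * hcc

/-- The second fundamental form of a distribution with the Clairaut property. -/
theorem clairaut_secondFundamentalForm {f : M → ℝ} {W : Set M}
    {R : Π y : M, Submodule ℝ (TangentSpace 𝓘(ℝ, E) y)} (hW : IsOpen W)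
    (hR : ∀ (β : ℝ → M) (J : Set ℝ), IsOpen J → J.OrdConnected → (∀ t ∈ J, β t ∈ W) →
      IsGeodesicOn g β J →
      ∃ c : ℝ, ∀ t ∈ J, ∀ V ∈ perp g (R (β t)), velocity (E' := E) β t - V ∈ R (β t) →
        Real.exp (f (β t)) * Real.sin (angle g (velocity (E' := E) β t) V) = c)
    {y : M} (hy : y ∈ W) (hf : MDifferentiableAt 𝓘(ℝ, E) 𝓘(ℝ, ℝ) f y)
    {Z : Π y : M, TangentSpace 𝓘(ℝ, E) y} (hZ : MDiffAt (T% Z) y) (hZR : ∀ᶠ z in 𝓝 y, Z z ∈ R z)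
    {n : TangentSpace 𝓘(ℝ, E) y} (hn : n ∈ perp g (R y)) :
    g.inner y (leviCivita g Z y (Z y)) n =
      -(g.inner y (Z y) (Z y) * mvfderiv 𝓘(ℝ, E) f y n) := by
  -- Adding the identities for (Z, n) and (-Z, n) cancels the terms in df(Z) and g(∇_n Z, n), and
  -- leaves twice the claim.
  have h1 := clairaut_derivative g hW hR hy hf hZ hZR hn
  have hneg : MDiffAt
      (T% ((fun _ : M ↦ (-1 : ℝ)) • Z : Π y : M, TangentSpace 𝓘(ℝ, E) y)) y :=
    MDiffAlongAt.smul (b := id) mdifferentiableAt_const hZ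
  have h2 := clairaut_derivative g hW hR hy hf hneg
    (hZR.mono fun z hz ↦ by simpa using hz) hn
  rw [(leviCivita g).isCovariantDerivativeOnUniv.leibniz hZ mdifferentiableAt_const,
    mvfderiv_const] at h2
  simp only [Pi.smul_apply', map_add, _root_.add_apply,
    neg_smul, one_smul, map_neg, _root_.neg_apply] at h1 h2
  simp at h2
  linarith

end Clairaut

/-! ### Riemannian maps, the adjoint of the differential, and horizontal lifts. -/

section RiemannianMap

variable {E : Type*} [NormedAddCommGroup E] [NormedSpace ℝ E] [FiniteDimensional ℝ E]
  {M : Type*} [TopologicalSpace M] [ChartedSpace E M] [IsManifold 𝓘(ℝ, E) ∞ M]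
  {E' : Type*} [NormedAddCommGroup E'] [NormedSpace ℝ E'] [FiniteDimensional ℝ E']
  {N : Type*} [TopologicalSpace N] [ChartedSpace E' N] [IsManifold 𝓘(ℝ, E') ∞ N]
  (gM : RMetric E M) (gN : RMetric E' N) {F : M → N} {q : M}

theorem exists_mem_perp_ker_mfderiv_eq (x : TangentSpace 𝓘(ℝ, E) q) :
    ∃ y ∈ perp gM (ker (E := E) (E' := E') F q),
      mfderiv 𝓘(ℝ, E) 𝓘(ℝ, E') F q x = mfderiv 𝓘(ℝ, E) 𝓘(ℝ, E') F q y ∧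
      ∀ z ∈ perp gM (ker (E := E) (E' := E') F q), gM.inner q x z = gM.inner q y z := by
  obtain ⟨y, hy, hxy⟩ := exists_mem_perp_sub_mem gM (ker (E := E) (E' := E') F q) x
  refine ⟨y, hy, ?_, fun z hz ↦ ?_⟩
  · have h : mfderiv 𝓘(ℝ, E) 𝓘(ℝ, E') F q (x - y) = 0 := hxy
    rwa [map_sub, sub_eq_zero] at h
  · have h := hz _ hxy
    change gM.inner q (x - y) z = 0 at h
    simpa [sub_eq_zero] using h

variable (F q) in
/-- The adjoint of the differential of `F`. -/
def adjoint : TangentSpace 𝓘(ℝ, E') (F q) →ₗ[ℝ] TangentSpace 𝓘(ℝ, E) q where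
  toFun e := sharp gM q ((gN.inner (F q) e).comp (mfderiv 𝓘(ℝ, E) 𝓘(ℝ, E') F q))
  map_add' e e' := by rw [← map_add]; simp
  map_smul' c e := by rw [← map_smul]; simp

theorem inner_adjoint (e : TangentSpace 𝓘(ℝ, E') (F q)) (x : TangentSpace 𝓘(ℝ, E) q) :
    gM.inner q (adjoint gM gN F q e) x =
      gN.inner (F q) e (mfderiv 𝓘(ℝ, E) 𝓘(ℝ, E') F q x) :=
  inner_sharp gM q _ x

theorem adjoint_mem_perp (e : TangentSpace 𝓘(ℝ, E') (F q)) :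
    adjoint gM gN F q e ∈ perp gM (ker (E := E) (E' := E') F q) := by
  intro x hx
  have hx : mfderiv 𝓘(ℝ, E) 𝓘(ℝ, E') F q x = 0 := hx
  refine (gM.symm q x _).trans ((inner_adjoint gM gN e x).trans ?_)
  rw [hx, map_zero]

variable {gM gN}

/-- One horizontal argument is enough, because the vertical part of the other contributes nothing to
either side. -/
theorem IsRiemannianMap.inner_mfderiv (hF : IsRiemannianMap gM gN F)
    {x : TangentSpace 𝓘(ℝ, E) q} (hx : x ∈ perp gM (ker (E := E) (E' := E') F q))
    (z : TangentSpace 𝓘(ℝ, E) q) :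
    gN.inner (F q) (mfderiv 𝓘(ℝ, E) 𝓘(ℝ, E') F q x) (mfderiv 𝓘(ℝ, E) 𝓘(ℝ, E') F q z) =
      gM.inner q x z := by
  obtain ⟨y, hy, h1, h2⟩ := exists_mem_perp_ker_mfderiv_eq gM (F := F) (E' := E') z
  rw [h1, hF.isometry q x hx y hy, gM.symm q x y, ← h2 x hx, gM.symm]

/-- F_* is a partial isometry, so its adjoint inverts it between the horizontal space and the range.
The adjoint thereby provides horizontal lifts, and adjoint ∘ F_* is the orthogonal projection to the
horizontal space. -/
theorem IsRiemannianMap.adjoint_mfderiv (hF : IsRiemannianMap gM gN F)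
    {x : TangentSpace 𝓘(ℝ, E) q} (hx : x ∈ perp gM (ker (E := E) (E' := E') F q)) :
    adjoint gM gN F q (mfderiv 𝓘(ℝ, E) 𝓘(ℝ, E') F q x) = x :=
  eq_of_inner_eq gM fun z ↦ by rw [inner_adjoint, hF.inner_mfderiv hx]

theorem IsRiemannianMap.mfderiv_adjoint (hF : IsRiemannianMap gM gN F)
    {e : TangentSpace 𝓘(ℝ, E') (F q)} (he : e ∈ range (E := E) F q) :
    mfderiv 𝓘(ℝ, E) 𝓘(ℝ, E') F q (adjoint gM gN F q e) = e := by
  obtain ⟨x, rfl⟩ := he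
  obtain ⟨y, hy, h1, -⟩ := exists_mem_perp_ker_mfderiv_eq gM (F := F) (E' := E') x
  change mfderiv 𝓘(ℝ, E) 𝓘(ℝ, E') F q (adjoint gM gN F q (mfderiv 𝓘(ℝ, E) 𝓘(ℝ, E') F q x)) =
    mfderiv 𝓘(ℝ, E) 𝓘(ℝ, E') F q x
  rw [h1, hF.adjoint_mfderiv hy]

theorem mfderiv_mem_range (x : TangentSpace 𝓘(ℝ, E) q) :
    mfderiv 𝓘(ℝ, E) 𝓘(ℝ, E') F q x ∈ range (E := E) (E' := E') F q :=
  ⟨x, rfl⟩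

theorem contMDiffAt_mfderiv (hF : ContMDiff 𝓘(ℝ, E) 𝓘(ℝ, E') ∞ F)
    {Y : Π x : M, TangentSpace 𝓘(ℝ, E) x}
    (hY : ContMDiffAt 𝓘(ℝ, E) (𝓘(ℝ, E).prod 𝓘(ℝ, E)) ∞
      (fun x ↦ (⟨x, Y x⟩ : TangentBundle 𝓘(ℝ, E) M)) q) :
    ContMDiffAt 𝓘(ℝ, E) (𝓘(ℝ, E').prod 𝓘(ℝ, E')) ∞
      (fun p ↦ (⟨F p, mfderiv 𝓘(ℝ, E) 𝓘(ℝ, E') F p (Y p)⟩ : TangentBundle 𝓘(ℝ, E') N)) q :=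
  ((hF.contMDiff_tangentMap (m := ∞) (by simp)) (⟨q, Y q⟩ : TangentBundle 𝓘(ℝ, E) M)).comp q hY

theorem mdiffAlongAt_mfderiv (hF : ContMDiff 𝓘(ℝ, E) 𝓘(ℝ, E') ∞ F)
    {Y : Π x : M, TangentSpace 𝓘(ℝ, E) x} (hY : MDiffAt (T% Y) q) :
    MDiffAlongAt E F (fun p ↦ mfderiv 𝓘(ℝ, E) 𝓘(ℝ, E') F p (Y p)) q :=
  MDifferentiableAt.comp (f := fun x ↦ (⟨x, Y x⟩ : TangentBundle 𝓘(ℝ, E) M))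
    (g := tangentMap 𝓘(ℝ, E) 𝓘(ℝ, E') F) q
    ((hF.contMDiff_tangentMap (m := ∞) (by simp)).mdifferentiable (by simp) _) hY

-- The inner product of the adjoint of V with a frame field is that of V with the image of the frame
-- field under F_*, which is smooth.
variable (gM gN) in
theorem contMDiffAt_adjoint (hF : ContMDiff 𝓘(ℝ, E) 𝓘(ℝ, E') ∞ F)
    {V : Π p : M, TangentSpace 𝓘(ℝ, E') (F p)}
    (hV : ContMDiffAt 𝓘(ℝ, E) (𝓘(ℝ, E').prod 𝓘(ℝ, E')) ∞
      (fun p ↦ (⟨F p, V p⟩ : TangentBundle 𝓘(ℝ, E') N)) q) :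
    ContMDiffAt 𝓘(ℝ, E) (𝓘(ℝ, E).prod 𝓘(ℝ, E)) ∞
      (fun x ↦ (⟨x, adjoint gM gN F x (V x)⟩ : TangentBundle 𝓘(ℝ, E) M)) q := by
  refine contMDiffAt_of_inner gM fun i ↦ ?_
  have hfr := contMDiffAt_localFrame_of_mem (I := 𝓘(ℝ, E)) ∞ (tangentTriv (E' := E) q)
    (Module.finBasis ℝ E) i (FiberBundle.mem_baseSet_trivializationAt' (F := E) q)
  refine (contMDiffAt_inner gN hV (contMDiffAt_mfderiv hF hfr)).congr_of_eventuallyEq ?_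
  exact Filter.Eventually.of_forall fun p ↦ inner_adjoint gM gN (V p) _

theorem IsSectionOn.contMDiffAt {D : Π x : M, Submodule ℝ (TangentSpace 𝓘(ℝ, E) x)} {O : Set M}
    {X : Π x : M, TangentSpace 𝓘(ℝ, E) x} (hX : IsSectionOn D O X) (hO : IsOpen O) (hq : q ∈ O) :
    ContMDiffAt 𝓘(ℝ, E) (𝓘(ℝ, E).prod 𝓘(ℝ, E)) ∞
      (fun x ↦ (⟨x, X x⟩ : TangentBundle 𝓘(ℝ, E) M)) q :=
  hX.1.contMDiffAt (hO.mem_nhds hq)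

theorem IsSectionOn.mdiffAt {D : Π x : M, Submodule ℝ (TangentSpace 𝓘(ℝ, E) x)} {O : Set M}
    {X : Π x : M, TangentSpace 𝓘(ℝ, E) x} (hX : IsSectionOn D O X) (hO : IsOpen O) (hq : q ∈ O) :
    MDiffAt (T% X) q :=
  (hX.contMDiffAt hO hq).mdifferentiableAt (by simp)

theorem IsSectionOn.mono {D : Π x : M, Submodule ℝ (TangentSpace 𝓘(ℝ, E) x)} {O O' : Set M}
    {X : Π x : M, TangentSpace 𝓘(ℝ, E) x} (hX : IsSectionOn D O X) (h : O' ⊆ O) :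
    IsSectionOn D O' X :=
  ⟨hX.1.mono h, fun x hx ↦ hX.2 x (h hx)⟩

/-- A vector in a smooth distribution extends to a local section. -/
theorem exists_isSectionOn {D : Π x : M, Submodule ℝ (TangentSpace 𝓘(ℝ, E) x)} {S : Set M}
    (hD : IsSmoothSubbundleOn (EA := E) (A := M) (N := M) (fun x ↦ x) D S) (hq : q ∈ S)
    {x : TangentSpace 𝓘(ℝ, E) q} (hx : x ∈ D q) :
    ∃ O : Set M, IsOpen O ∧ q ∈ O ∧ ∃ X, IsSectionOn D O X ∧ X q = x := by
  obtain ⟨O, hO, hqO, k, e, he, hs⟩ := hD q hq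
  rw [← (hs q hqO).2] at hx
  obtain ⟨c, rfl⟩ := (Submodule.mem_span_range_iff_exists_fun ℝ).1 hx
  refine ⟨O, hO, hqO, fun p ↦ ∑ i, c i • e i p, ⟨?_, fun p hp ↦ ?_⟩, rfl⟩
  · exact ContMDiffOn.sum_section fun i _ ↦ (he i).const_smul_section
  · rw [← (hs p hp).2]
    exact (Submodule.mem_span_range_iff_exists_fun ℝ).2 ⟨c, rfl⟩

theorem IsRiemannianMap.adjoint_mem_lift (hF : IsRiemannianMap gM gN F)
    {D : Π q : M, Submodule ℝ (TangentSpace 𝓘(ℝ, E') (F q))}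
    (hDR : ∀ q, D q ≤ range (E := E) (E' := E') F q) {e : TangentSpace 𝓘(ℝ, E') (F q)}
    (he : e ∈ D q) : adjoint gM gN F q e ∈ lift gM F D q := by
  refine ⟨adjoint_mem_perp gM gN e, ?_⟩
  change mfderiv 𝓘(ℝ, E) 𝓘(ℝ, E') F q (adjoint gM gN F q e) ∈ D q
  rwa [hF.mfderiv_adjoint (hDR q he)]

theorem IsRiemannianMap.isSmoothSubbundleOn_lift (hF : IsRiemannianMap gM gN F)
    {D : Π q : M, Submodule ℝ (TangentSpace 𝓘(ℝ, E') (F q))}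
    (hD : IsSmoothSubbundleOn (EA := E) F D Set.univ)
    (hDR : ∀ q, D q ≤ range (E := E) (E' := E') F q) :
    IsSmoothSubbundleOn (EA := E) (A := M) (N := M) (fun x ↦ x) (lift gM F D) Set.univ := by
  intro q _
  obtain ⟨O, hO, hqO, k, e, he, hs⟩ := hD q trivial
  refine ⟨O, hO, hqO, k, fun i p ↦ adjoint gM gN F p (e i p), fun i p hp ↦
    (contMDiffAt_adjoint gM gN hF.smooth ((he i).contMDiffAt (hO.mem_nhds hp))).contMDiffWithinAt,
    fun p hp ↦ ?_⟩
  obtain ⟨hli, hsp⟩ := hs p hp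
  have heD : ∀ i, e i p ∈ D p := fun i ↦ hsp ▸ Submodule.subset_span ⟨i, rfl⟩
  have h1 : ∀ i, (mfderiv 𝓘(ℝ, E) 𝓘(ℝ, E') F p).toLinearMap (adjoint gM gN F p (e i p)) = e i p :=
    fun i ↦ hF.mfderiv_adjoint (hDR p (heD i))
  constructor
  · refine LinearIndependent.of_comp (mfderiv 𝓘(ℝ, E) 𝓘(ℝ, E') F p).toLinearMap ?_
    convert hli using 1
    exact funext h1
  · apply le_antisymm
    · rw [Submodule.span_le]
      rintro _ ⟨i, rfl⟩
      exact hF.adjoint_mem_lift hDR (heD i)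
    · rintro x ⟨hx, hxD⟩
      have hxD : mfderiv 𝓘(ℝ, E) 𝓘(ℝ, E') F p x ∈ D p := hxD
      rw [← hsp] at hxD
      obtain ⟨c, hc⟩ := (Submodule.mem_span_range_iff_exists_fun ℝ).1 hxD
      refine (Submodule.mem_span_range_iff_exists_fun ℝ).2 ⟨c, ?_⟩
      rw [← hF.adjoint_mfderiv hx, ← hc, map_sum]
      simp

theorem exists_contMDiffAt_eq (x : TangentSpace 𝓘(ℝ, E) q) :
    ∃ O : Set M, IsOpen O ∧ q ∈ O ∧ ∃ X : Π x : M, TangentSpace 𝓘(ℝ, E) x,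
      (∀ p ∈ O, ContMDiffAt 𝓘(ℝ, E) (𝓘(ℝ, E).prod 𝓘(ℝ, E)) ∞
        (fun x ↦ (⟨x, X x⟩ : TangentBundle 𝓘(ℝ, E) M)) p) ∧ X q = x := by
  have hq := FiberBundle.mem_baseSet_trivializationAt' (F := E)
    (E := fun y : M ↦ TangentSpace 𝓘(ℝ, E) y) q
  refine ⟨_, (tangentTriv (E' := E) q).open_baseSet, hq, fun p ↦ ∑ i,
    (tangentTriv (E' := E) q).localFrameCoeff 𝓘(ℝ, E) (Module.finBasis ℝ E) i q x •
      (tangentTriv (E' := E) q).localFrame (Module.finBasis ℝ E) i p, fun p hp ↦ ?_,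
    sum_localFrameCoeff_tangentTriv hq x⟩
  exact ContMDiffAt.sum_section fun i _ ↦
    (contMDiffAt_localFrame_of_mem (I := 𝓘(ℝ, E)) ∞ (tangentTriv (E' := E) q)
      (Module.finBasis ℝ E) i hp).const_smul_section

/-- A vertical vector extends to a local vertical field. -/
theorem IsRiemannianMap.exists_isSectionOn_ker (hF : IsRiemannianMap gM gN F)
    {u : TangentSpace 𝓘(ℝ, E) q} (hu : u ∈ ker (E' := E') F q) :
    ∃ O : Set M, IsOpen O ∧ q ∈ O ∧ ∃ U, IsSectionOn (ker (E := E) (E' := E') F) O U ∧ U q = u := by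
  obtain ⟨O, hO, hq, X, hX, rfl⟩ := exists_contMDiffAt_eq u
  -- Subtracting the horizontal projection makes the extension vertical without changing its value
  -- at `q`.
  refine ⟨O, hO, hq, fun p ↦ X p - adjoint gM gN F p (mfderiv 𝓘(ℝ, E) 𝓘(ℝ, E') F p (X p)),
    ⟨fun p hp ↦ ?_, fun p hp ↦ ?_⟩, ?_⟩
  · exact ((hX p hp).sub_section (contMDiffAt_adjoint gM gN hF.smooth
      (contMDiffAt_mfderiv hF.smooth (hX p hp)))).contMDiffWithinAt
  · change mfderiv 𝓘(ℝ, E) 𝓘(ℝ, E') F p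
      (X p - adjoint gM gN F p (mfderiv 𝓘(ℝ, E) 𝓘(ℝ, E') F p (X p))) = 0
    rw [map_sub, hF.mfderiv_adjoint (mfderiv_mem_range _), sub_self]
  · have hu : mfderiv 𝓘(ℝ, E) 𝓘(ℝ, E') F q (X q) = 0 := hu
    simp [hu]

/-- A vector orthogonal to the fibres extends to a local field orthogonal to the fibres. -/
theorem IsRiemannianMap.exists_horizontal (hF : IsRiemannianMap gM gN F)
    {x : TangentSpace 𝓘(ℝ, E) q} (hx : x ∈ perp gM (ker (E' := E') F q)) :
    ∃ X : Π x : M, TangentSpace 𝓘(ℝ, E) x, MDiffAt (T% X) q ∧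
      (∀ p, X p ∈ perp gM (ker (E := E) (E' := E') F p)) ∧ X q = x := by
  obtain ⟨O, hO, hq, X, hX, rfl⟩ := exists_contMDiffAt_eq x
  exact ⟨fun p ↦ adjoint gM gN F p (mfderiv 𝓘(ℝ, E) 𝓘(ℝ, E') F p (X p)),
    (contMDiffAt_adjoint gM gN hF.smooth (contMDiffAt_mfderiv hF.smooth (hX q hq))).mdifferentiableAt
      (by simp), fun p ↦ adjoint_mem_perp gM gN _, hF.adjoint_mfderiv hx⟩

end RiemannianMap

/-! ### The second fundamental form of a Riemannian map. -/

section SecondFundamentalForm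

variable {E : Type*} [NormedAddCommGroup E] [NormedSpace ℝ E] [FiniteDimensional ℝ E]
  {M : Type*} [TopologicalSpace M] [ChartedSpace E M] [IsManifold 𝓘(ℝ, E) ∞ M]
  {E' : Type*} [NormedAddCommGroup E'] [NormedSpace ℝ E'] [FiniteDimensional ℝ E']
  {N : Type*} [TopologicalSpace N] [ChartedSpace E' N] [IsManifold 𝓘(ℝ, E') ∞ N]
  {gM : RMetric E M} {gN : RMetric E' N} {F : M → N} {q : M}

/-- Both connections are torsion-free, so the antisymmetric part is F_*[X, Y] - F_*[X, Y]. -/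
theorem secondFundamentalForm_symm (hF : ContMDiff 𝓘(ℝ, E) 𝓘(ℝ, E') ∞ F)
    {X Y : Π x : M, TangentSpace 𝓘(ℝ, E) x} (hX : MDiffAt (T% X) q) (hY : MDiffAt (T% Y) q) :
    secondFundamentalForm gM gN F X Y q = secondFundamentalForm gM gN F Y X q := by
  have h1 := covDerivAlong_torsion gN hF hX hY
  rw [← leviCivita_torsion gM hX hY, map_sub] at h1
  unfold secondFundamentalForm
  rw [sub_eq_sub_iff_sub_eq_sub]
  exact h1

/-- Dependence on the value alone is evident in the first argument; symmetry transfers it to the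
second. -/
theorem secondFundamentalForm_congr (hF : ContMDiff 𝓘(ℝ, E) 𝓘(ℝ, E') ∞ F)
    {X X' Y Y' : Π x : M, TangentSpace 𝓘(ℝ, E) x} (hX : MDiffAt (T% X) q)
    (hY : MDiffAt (T% Y) q) (hY' : MDiffAt (T% Y') q) (h : X q = X' q) (h' : Y q = Y' q) :
    secondFundamentalForm gM gN F X Y q = secondFundamentalForm gM gN F X' Y' q := by
  have e1 : secondFundamentalForm gM gN F X' Y' q = secondFundamentalForm gM gN F X Y' q := by
    unfold secondFundamentalForm
    rw [h]
  have e2 : secondFundamentalForm gM gN F Y X q = secondFundamentalForm gM gN F Y' X q := by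
    unfold secondFundamentalForm
    rw [h']
  rw [e1, secondFundamentalForm_symm hF hX hY, e2, secondFundamentalForm_symm hF hY' hX]

theorem secondFundamentalForm_add_left
    {X X' Y : Π x : M, TangentSpace 𝓘(ℝ, E) x} :
    secondFundamentalForm gM gN F (X + X') Y q =
      secondFundamentalForm gM gN F X Y q + secondFundamentalForm gM gN F X' Y q := by
  have : covDerivAlong gN F (fun p ↦ mfderiv 𝓘(ℝ, E) 𝓘(ℝ, E') F p (Y p)) q (X q + X' q) =
      covDerivAlong gN F (fun p ↦ mfderiv 𝓘(ℝ, E) 𝓘(ℝ, E') F p (Y p)) q (X q) +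
      covDerivAlong gN F (fun p ↦ mfderiv 𝓘(ℝ, E) 𝓘(ℝ, E') F p (Y p)) q (X' q) := by
    simp only [covDerivAlong, map_add, add_smul, smul_add, ← Finset.sum_add_distrib]
    exact Finset.sum_congr rfl fun i _ ↦ by abel
  simp only [secondFundamentalForm, Pi.add_apply, map_add, this]
  abel

/-- The second fundamental form is normal to `range F_*` on horizontal vectors. -/
theorem IsRiemannianMap.inner_secondFundamentalForm_mfderiv (hF : IsRiemannianMap gM gN F)
    {X Y : Π x : M, TangentSpace 𝓘(ℝ, E) x} {z : TangentSpace 𝓘(ℝ, E) q}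
    (hX : MDiffAt (T% X) q) (hY : MDiffAt (T% Y) q)
    (hXH : X q ∈ perp gM (ker (E := E) (E' := E') F q))
    (hYH : Y q ∈ perp gM (ker (E := E) (E' := E') F q)) :
    gN.inner (F q) (secondFundamentalForm gM gN F X Y q) (mfderiv 𝓘(ℝ, E) 𝓘(ℝ, E') F q z) = 0 := by
  obtain ⟨z', hz', h1, -⟩ := exists_mem_perp_ker_mfderiv_eq gM (F := F) (E' := E') z
  rw [h1]
  obtain ⟨X', hX', hX'H, hX'q⟩ := hF.exists_horizontal hXH
  obtain ⟨Y', hY', hY'H, hY'q⟩ := hF.exists_horizontal hYH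
  obtain ⟨Z, hZ, hZH, rfl⟩ := hF.exists_horizontal hz'
  rw [secondFundamentalForm_congr hF.smooth hX hY hY' hX'q.symm hY'q.symm]
  -- For horizontal fields g_N(F_* B, F_* C) = g_M(B, C) as functions; differentiate both sides
  -- along A and subtract.
  have anti : ∀ {A B C : Π x : M, TangentSpace 𝓘(ℝ, E) x}, MDiffAt (T% A) q → MDiffAt (T% B) q →
      MDiffAt (T% C) q → (∀ p, B p ∈ perp gM (ker (E := E) (E' := E') F p)) →
      (∀ p, C p ∈ perp gM (ker (E := E) (E' := E') F p)) →
      gN.inner (F q) (secondFundamentalForm gM gN F A B q) (mfderiv 𝓘(ℝ, E) 𝓘(ℝ, E') F q (C q)) =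
      -gN.inner (F q) (secondFundamentalForm gM gN F A C q)
        (mfderiv 𝓘(ℝ, E) 𝓘(ℝ, E') F q (B q)) := by
    intro A B C hA hB hC hBH hCH
    have h1 := covDerivAlong_metric gN (mdiffAlongAt_mfderiv hF.smooth hB)
      (mdiffAlongAt_mfderiv hF.smooth hC) (A q)
    have h2 := leviCivita_metric gM hA hB hC
    have h3 : (fun p ↦ gN.inner (F p) (mfderiv 𝓘(ℝ, E) 𝓘(ℝ, E') F p (B p))
      (mfderiv 𝓘(ℝ, E) 𝓘(ℝ, E') F p (C p))) = fun p ↦ gM.inner p (B p) (C p) :=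
      funext fun p ↦ hF.inner_mfderiv (hBH p) _
    rw [h3, h2] at h1
    have h4 := hF.inner_mfderiv (hCH q) (leviCivita gM B q (A q))
    have h5 := hF.inner_mfderiv (hBH q) (leviCivita gM C q (A q))
    rw [gN.symm, gM.symm] at h4
    rw [gN.symm _ (mfderiv 𝓘(ℝ, E) 𝓘(ℝ, E') F q (B q)) (covDerivAlong _ _ _ _ _)] at h1
    rw [gN.symm _ (mfderiv 𝓘(ℝ, E) 𝓘(ℝ, E') F q (B q))] at h5
    simp only [secondFundamentalForm, map_sub, _root_.sub_apply]
    linarith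
  -- A trilinear form that is symmetric in its first two arguments and antisymmetric in its last two
  -- is zero: alternating the two symmetries returns to the start with the opposite sign.
  have a1 := anti hX' hY' hZ hY'H hZH
  have a2 := anti hZ hX' hY' hX'H hY'H
  have a3 := anti hY' hZ hX' hZH hX'H
  have s1 := secondFundamentalForm_symm (gM := gM) (gN := gN) hF.smooth hX' hZ
  have s2 := secondFundamentalForm_symm (gM := gM) (gN := gN) hF.smooth hZ hY'
  have s3 := secondFundamentalForm_symm (gM := gM) (gN := gN) hF.smooth hY' hX'
  rw [s1] at a1
  rw [s2] at a2
  rw [s3] at a3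
  linarith

theorem IsRiemannianMap.inner_leviCivita (hF : IsRiemannianMap gM gN F)
    {X Y : Π x : M, TangentSpace 𝓘(ℝ, E) x} {z : TangentSpace 𝓘(ℝ, E) q}
    (hX : MDiffAt (T% X) q) (hY : MDiffAt (T% Y) q)
    (hXH : X q ∈ perp gM (ker (E := E) (E' := E') F q))
    (hYH : Y q ∈ perp gM (ker (E := E) (E' := E') F q))
    (hz : z ∈ perp gM (ker (E := E) (E' := E') F q)) :
    gM.inner q (leviCivita gM Y q (X q)) z =
      gN.inner (F q) (covDerivAlong gN F (fun p ↦ mfderiv 𝓘(ℝ, E) 𝓘(ℝ, E') F p (Y p)) q (X q))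
        (mfderiv 𝓘(ℝ, E) 𝓘(ℝ, E') F q z) := by
  have h1 := hF.inner_secondFundamentalForm_mfderiv (z := z) hX hY hXH hYH
  have h2 := hF.inner_mfderiv hz (leviCivita gM Y q (X q))
  rw [gN.symm, gM.symm] at h2
  simp only [secondFundamentalForm, map_sub, _root_.sub_apply] at h1
  linarith

/-- The component of `∇_X Y` along the fibres. -/
theorem IsRiemannianMap.inner_leviCivita_vertical (hF : IsRiemannianMap gM gN F)
    {X Y U : Π x : M, TangentSpace 𝓘(ℝ, E) x}
    (hX : MDiffAt (T% X) q) (hY : MDiffAt (T% Y) q) (hU : MDiffAt (T% U) q)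
    (hYH : ∀ᶠ p in 𝓝 q, Y p ∈ perp gM (ker (E := E) (E' := E') F p))
    (hUV : ∀ᶠ p in 𝓝 q, U p ∈ ker (E := E) (E' := E') F p) :
    gM.inner q (U q) (leviCivita gM Y q (X q)) =
      gN.inner (F q) (mfderiv 𝓘(ℝ, E) 𝓘(ℝ, E') F q (Y q))
        (secondFundamentalForm gM gN F X U q) := by
  have h1 := leviCivita_metric gM hX hY hU
  have h2 : (fun p ↦ gM.inner p (Y p) (U p)) =ᶠ[𝓝 q] fun _ ↦ 0 := by
    filter_upwards [hYH, hUV] with p hp hp'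
    exact (gM.symm _ _ _).trans (hp _ hp')
  rw [mvfderiv_congr h2, mvfderiv_const] at h1
  -- Since F_* U vanishes near `q`, (∇F_*)(X, U) is just -F_*(∇_X U).
  have h3 : ∀ᶠ p in 𝓝 q, mfderiv 𝓘(ℝ, E) 𝓘(ℝ, E') F p (U p) =
      (0 : Π p : M, TangentSpace 𝓘(ℝ, E') (F p)) p := hUV.mono fun p hp ↦ hp
  have h4 := (covDerivAlong_congr gN h3 (X q)).trans (covDerivAlong_zero gN _)
  have h5 := hF.inner_mfderiv hYH.self_of_nhds (leviCivita gM U q (X q))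
  rw [secondFundamentalForm, h4, zero_sub, map_neg, h5, gM.symm]
  simp only [_root_.zero_apply] at h1
  linarith

end SecondFundamentalForm

/-! ### Clairaut semi-invariant maps to a Kähler manifold. -/

section ClairautMap

variable {E : Type*} [NormedAddCommGroup E] [NormedSpace ℝ E] [FiniteDimensional ℝ E]
  {M : Type*} [TopologicalSpace M] [ChartedSpace E M] [IsManifold 𝓘(ℝ, E) ∞ M]
  {E' : Type*} [NormedAddCommGroup E'] [NormedSpace ℝ E'] [FiniteDimensional ℝ E']
  {N : Type*} [TopologicalSpace N] [ChartedSpace E' N] [IsManifold 𝓘(ℝ, E') ∞ N]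
  {gM : RMetric E M} {gN : RMetric E' N} {F : M → N} {q : M} {f : N → ℝ}

/-- Since ∇F_* is tensorial, X in the second slot may be replaced by the horizontal lift of a
section Z of R with Z = F_* X at `F q`. The normal part of ∇F_* becomes that of ∇_Z Z on the target,
which `clairaut_secondFundamentalForm` computes. -/
theorem IsRiemannianMap.clairaut_self (hF : IsRiemannianMap gM gN F)
    (hf : ContMDiff 𝓘(ℝ, E') 𝓘(ℝ, ℝ) ∞ f)
    (hC : IsClairaut (E := E) gN F (fun y ↦ Real.exp (f y)))
    {X : Π x : M, TangentSpace 𝓘(ℝ, E) x} (hX : MDiffAt (T% X) q)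
    (hXH : X q ∈ perp gM (ker (E := E) (E' := E') F q))
    {n : TangentSpace 𝓘(ℝ, E') (F q)} (hn : n ∈ perp gN (range (E := E) F q)) :
    gN.inner (F q) (secondFundamentalForm gM gN F X X q) n =
      -(gM.inner q (X q) (X q) * mvfderiv 𝓘(ℝ, E') f (F q) n) := by
  obtain ⟨-, W, R, hW, hFW, hRs, hRF, hgeo⟩ := hC
  obtain ⟨O, hO, hqO, Z, hZ, hZq⟩ := exists_isSectionOn hRs (hFW ⟨q, rfl⟩)
    (x := mfderiv 𝓘(ℝ, E) 𝓘(ℝ, E') F q (X q)) (by rw [hRF]; exact mfderiv_mem_range _)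
  have hFq : ContMDiffAt 𝓘(ℝ, E) 𝓘(ℝ, E') ∞ F q := hF.smooth q
  have hZd : MDiffAt (T% Z) (F q) := hZ.mdiffAt hO hqO
  have hZF := ContMDiffAt.comp (f := F) q (hZ.contMDiffAt hO hqO) hFq
  have hY : MDiffAt (T% (fun p ↦ adjoint gM gN F p (Z (F p)))) q :=
    (contMDiffAt_adjoint gM gN hF.smooth hZF).mdifferentiableAt (by simp)
  have hYq : X q = adjoint gM gN F q (Z (F q)) := by
    rw [hZq, hF.adjoint_mfderiv hXH]
  have hFY : ∀ᶠ p in 𝓝 q, mfderiv 𝓘(ℝ, E) 𝓘(ℝ, E') F p (adjoint gM gN F p (Z (F p))) =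
      Z (F p) := by
    filter_upwards [hFq.continuousAt.eventually (hO.mem_nhds hqO)] with p hp
    exact hF.mfderiv_adjoint (hRF p ▸ hZ.2 _ hp)
  rw [secondFundamentalForm_congr (X' := X)
    (Y' := fun p ↦ adjoint gM gN F p (Z (F p))) hF.smooth hX hX hY rfl hYq]
  have h1 := (covDerivAlong_congr gN hFY (X q)).trans
    (covDerivAlong_comp gN (hFq.mdifferentiableAt (by simp)) hZd (X q))
  rw [← hZq] at h1
  have h2 := clairaut_secondFundamentalForm gN hW hgeo (hFW ⟨q, rfl⟩)
    (hf.mdifferentiable (by simp) (F q)) hZd (Filter.eventually_of_mem (hO.mem_nhds hqO) hZ.2)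
    (n := n) (by rwa [hRF])
  have h3 := hn _ (mfderiv_mem_range (leviCivita gM (fun p ↦ adjoint gM gN F p (Z (F p))) q
    (X q)))
  change gN.inner (F q) _ n = 0 at h3
  rw [hZq, hF.inner_mfderiv hXH, ← hZq] at h2
  unfold secondFundamentalForm
  rw [map_sub, _root_.sub_apply, h3, sub_zero, ← h2, h1]

/-- The second fundamental form of a Clairaut Riemannian map on horizontal vectors. -/
theorem IsRiemannianMap.clairaut (hF : IsRiemannianMap gM gN F)
    (hf : ContMDiff 𝓘(ℝ, E') 𝓘(ℝ, ℝ) ∞ f)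
    (hC : IsClairaut (E := E) gN F (fun y ↦ Real.exp (f y)))
    {X Y : Π x : M, TangentSpace 𝓘(ℝ, E) x} (hX : MDiffAt (T% X) q) (hY : MDiffAt (T% Y) q)
    (hXH : X q ∈ perp gM (ker (E := E) (E' := E') F q))
    (hYH : Y q ∈ perp gM (ker (E := E) (E' := E') F q))
    {n : TangentSpace 𝓘(ℝ, E') (F q)} (hn : n ∈ perp gN (range (E := E) F q)) :
    gN.inner (F q) (secondFundamentalForm gM gN F X Y q) n =
      -(gM.inner q (X q) (Y q) * mvfderiv 𝓘(ℝ, E') f (F q) n) := by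
  -- Polarization of `IsRiemannianMap.clairaut_self`, both sides being symmetric and bilinear.
  have hXY : MDiffAt (T% (X + Y)) q := mdifferentiableAt_add_section hX hY
  have h1 := hF.clairaut_self hf hC hX hXH hn
  have h2 := hF.clairaut_self hf hC hY hYH hn
  have h3 := hF.clairaut_self hf hC hXY (Submodule.add_mem _ hXH hYH) hn
  rw [secondFundamentalForm_add_left, secondFundamentalForm_symm hF.smooth hX hXY,
    secondFundamentalForm_symm hF.smooth hY hXY, secondFundamentalForm_add_left,
    secondFundamentalForm_add_left, secondFundamentalForm_symm hF.smooth hY hX] at h3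
  have h4 := gM.symm q (X q) (Y q)
  simp only [Pi.add_apply, map_add, _root_.add_apply] at h3
  rw [h1, h2] at h3
  linear_combination (1 / 2) * h3 + (1 / 2) * mvfderiv 𝓘(ℝ, E') f (F q) n * h4

variable {P : Π y : N, TangentSpace 𝓘(ℝ, E') y →L[ℝ] TangentSpace 𝓘(ℝ, E') y}

theorem IsKahler.contMDiffAt_apply (hP : IsKahler gN P) {V : Π p : M, TangentSpace 𝓘(ℝ, E') (F p)}
    (hV : ContMDiffAt 𝓘(ℝ, E) (𝓘(ℝ, E').prod 𝓘(ℝ, E')) ∞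
      (fun p ↦ (⟨F p, V p⟩ : TangentBundle 𝓘(ℝ, E') N)) q) :
    ContMDiffAt 𝓘(ℝ, E) (𝓘(ℝ, E').prod 𝓘(ℝ, E')) ∞
      (fun p ↦ (⟨F p, P (F p) (V p)⟩ : TangentBundle 𝓘(ℝ, E') N)) q :=
  ContMDiffAt.clm_bundle_apply (F₁ := E') (F₂ := E')
    ((hP.smooth (F q)).comp q (contMDiffAt_totalSpace.1 hV).1) hV

theorem IsKahler.inner_apply_left (hP : IsKahler gN P) {y : N} (v w : TangentSpace 𝓘(ℝ, E') y) :
    gN.inner y (P y v) w = -gN.inner y v (P y w) := by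
  rw [← hP.isometry y (P y v) w, hP.sq, map_neg, _root_.neg_apply]

variable {D₁ D₂ : Π q : M, Submodule ℝ (TangentSpace 𝓘(ℝ, E') (F q))}

theorem IsSemiInvariant.le_range₁ (hF : IsSemiInvariant gM gN P F D₁ D₂) (q : M) :
    D₁ q ≤ range (E := E) F q :=
  hF.sup_eq q ▸ le_sup_left

theorem IsSemiInvariant.le_range₂ (hF : IsSemiInvariant gM gN P F D₁ D₂) (q : M) :
    D₂ q ≤ range (E := E) F q :=
  hF.sup_eq q ▸ le_sup_right

theorem IsSemiInvariant.apply_mem₁ (hF : IsSemiInvariant gM gN P F D₁ D₂)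
    {e : TangentSpace 𝓘(ℝ, E') (F q)} (he : e ∈ D₁ q) : P (F q) e ∈ D₁ q :=
  hF.invariant q ▸ Submodule.mem_map_of_mem he

theorem IsSemiInvariant.apply_mem₂ (hF : IsSemiInvariant gM gN P F D₁ D₂)
    {e : TangentSpace 𝓘(ℝ, E') (F q)} (he : e ∈ D₂ q) :
    P (F q) e ∈ perp gN (range (E := E) F q) :=
  hF.antiInvariant q (Submodule.mem_map_of_mem he)

/-- Orthogonality of the splitting is automatic: g(v, w) = g(Pv, Pw), where Pv is in range F_* and
Pw is normal to it. -/
theorem IsSemiInvariant.inner_eq_zero (hP : IsKahler gN P) (hF : IsSemiInvariant gM gN P F D₁ D₂)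
    {v w : TangentSpace 𝓘(ℝ, E') (F q)} (hv : v ∈ D₁ q) (hw : w ∈ D₂ q) :
    gN.inner (F q) v w = 0 := by
  rw [← hP.isometry]
  exact hF.apply_mem₂ hw _ (hF.le_range₁ q (hF.apply_mem₁ hv))

theorem exists_ne_zero_inner_eq_zero {y : N} {S : Submodule ℝ (TangentSpace 𝓘(ℝ, E') y)}
    (hS : 1 < Module.finrank ℝ S) (v : TangentSpace 𝓘(ℝ, E') y) :
    ∃ w ∈ S, w ≠ 0 ∧ gN.inner y v w = 0 := by
  have h := LinearMap.ker_ne_bot_of_finrank_lt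
    (f := (gN.inner y v).toLinearMap ∘ₗ S.subtype) (by simpa using hS)
  obtain ⟨w, hw, hw0⟩ := Submodule.exists_mem_ne_zero_of_ne_bot h
  exact ⟨w, w.2, by simpa using hw0, hw⟩

/-- The function `f` of a Clairaut map with `s = e^f` is constant in the directions `P D₂`. -/
theorem IsCSIRM.mvfderiv_eq_zero (hP : IsKahler gN P) (hf : ContMDiff 𝓘(ℝ, E') 𝓘(ℝ, ℝ) ∞ f)
    (hF : IsCSIRM gM gN P F D₁ D₂ (fun y ↦ Real.exp (f y)))
    (hdim : 1 < Module.finrank ℝ (D₂ q)) {e : TangentSpace 𝓘(ℝ, E') (F q)} (he : e ∈ D₂ q) :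
    mvfderiv 𝓘(ℝ, E') f (F q) (P (F q) e) = 0 := by
  -- The dimension bound gives a nonzero e' in D₂ orthogonal to e.
  obtain ⟨e', he', he0, hee⟩ := exists_ne_zero_inner_eq_zero (gN := gN) hdim e
  have hR := hF.toIsRiemannianMap
  have hsm := hR.isSmoothSubbundleOn_lift hF.smooth₂ hF.le_range₂
  obtain ⟨O, hO, hq, Y, hY, hYq⟩ := exists_isSectionOn hsm (Set.mem_univ q)
    (hR.adjoint_mem_lift hF.le_range₂ he')
  obtain ⟨O', hO', hq', Z, hZ, hZq⟩ := exists_isSectionOn hsm (Set.mem_univ q)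
    (hR.adjoint_mem_lift hF.le_range₂ he)
  have hYd := hY.mdiffAt hO hq
  have hZd := hZ.mdiffAt hO' hq'
  have hYe : mfderiv 𝓘(ℝ, E) 𝓘(ℝ, E') F q (Y q) = e' := by
    rw [hYq, hR.mfderiv_adjoint (hF.le_range₂ q he')]
  have hZe : mfderiv 𝓘(ℝ, E) 𝓘(ℝ, E') F q (Z q) = e := by
    rw [hZq, hR.mfderiv_adjoint (hF.le_range₂ q he)]
  have hYa := mdiffAlongAt_mfderiv hR.smooth hYd
  have hZa := mdiffAlongAt_mfderiv hR.smooth hZd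
  obtain ⟨hPY, hPYd⟩ := covDerivAlong_parallel gN hP hYa (Y q)
  have h1 := hR.clairaut hf hF.clairaut hYd hYd (hY.2 q hq).1 (hY.2 q hq).1 (hF.apply_mem₂ he)
  have h2 := hR.clairaut hf hF.clairaut hYd hZd (hY.2 q hq).1 (hZ.2 q hq').1 (hF.apply_mem₂ he')
  -- The differentiated function vanishes near `q`. With P moved across as a skew operator, the two
  -- terms on the right are |e'|² df(Pe) and -g(e', e) df(Pe') = 0.
  have h3 := covDerivAlong_metric gN hPY hZa (Y q)
  have h4 : (fun p ↦ gN.inner (F p) (P (F p) (mfderiv 𝓘(ℝ, E) 𝓘(ℝ, E') F p (Y p)))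
      (mfderiv 𝓘(ℝ, E) 𝓘(ℝ, E') F p (Z p))) =ᶠ[𝓝 q] fun _ ↦ 0 := by
    filter_upwards [hO.mem_nhds hq] with p hp
    exact (gN.symm _ _ _).trans (hF.apply_mem₂ (hY.2 p hp).2 _ (mfderiv_mem_range _))
  rw [mvfderiv_congr h4, mvfderiv_const, hPYd, hP.inner_apply_left, hYe, hZe] at h3
  have h5 : ∀ Z : Π x : M, TangentSpace 𝓘(ℝ, E) x, ∀ n ∈ perp gN (range (E := E) F q),
      gN.inner (F q) (secondFundamentalForm gM gN F Y Z q) n =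
      gN.inner (F q) (covDerivAlong gN F (fun p ↦ mfderiv 𝓘(ℝ, E) 𝓘(ℝ, E') F p (Z p)) q (Y q)) n := by
    intro Z n hn
    have : gN.inner (F q) (mfderiv 𝓘(ℝ, E) 𝓘(ℝ, E') F q (leviCivita gM Z q (Y q))) n = 0 :=
      hn _ (mfderiv_mem_range _)
    rw [secondFundamentalForm, map_sub, _root_.sub_apply, this, sub_zero]
  rw [h5 Y _ (hF.apply_mem₂ he)] at h1
  rw [h5 Z _ (hF.apply_mem₂ he')] at h2
  rw [gN.symm _ (P (F q) e'), h1, h2, ← hR.inner_mfderiv (hY.2 q hq).1,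
    ← hR.inner_mfderiv (hY.2 q hq).1, hYe, hZe, gN.symm _ e' e, hee] at h3
  simp only [_root_.zero_apply, zero_mul, neg_zero, add_zero, neg_neg] at h3
  exact (mul_eq_zero.1 h3.symm).resolve_left (gN.pos _ _ he0).ne'

/-- P carries the tangential component along F_* z to the normal component along P F_* z, which is a
multiple of df(P F_* z) = 0. X is any horizontal field, not only one in the lift of `D₁`, because
the counterpart for `D₂` needs this. -/
theorem IsCSIRM.inner_leviCivita₁ (hP : IsKahler gN P) (hf : ContMDiff 𝓘(ℝ, E') 𝓘(ℝ, ℝ) ∞ f)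
    (hF : IsCSIRM gM gN P F D₁ D₂ (fun y ↦ Real.exp (f y)))
    (hdim : 1 < Module.finrank ℝ (D₂ q)) {O : Set M} (hO : IsOpen O) (hq : q ∈ O)
    {X Y : Π x : M, TangentSpace 𝓘(ℝ, E) x} (hX : MDiffAt (T% X) q)
    (hXH : X q ∈ perp gM (ker (E := E) (E' := E') F q)) (hY : IsSectionOn (lift gM F D₁) O Y)
    {z : TangentSpace 𝓘(ℝ, E) q} (hz : z ∈ lift gM F D₂ q) :
    gM.inner q (leviCivita gM Y q (X q)) z = 0 := by
  have hR := hF.toIsRiemannianMap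
  have hYd := hY.mdiffAt hO hq
  have hYa := mdiffAlongAt_mfderiv hR.smooth hYd
  have hPY := (covDerivAlong_parallel gN hP hYa (X q)).2
  have hY' : MDiffAt (T% (fun p ↦ adjoint gM gN F p
      (P (F p) (mfderiv 𝓘(ℝ, E) 𝓘(ℝ, E') F p (Y p))))) q :=
    (contMDiffAt_adjoint gM gN hR.smooth (hP.contMDiffAt_apply (contMDiffAt_mfderiv hR.smooth
      (hY.contMDiffAt hO hq)))).mdifferentiableAt (by simp)
  have hFY' : ∀ᶠ p in 𝓝 q, mfderiv 𝓘(ℝ, E) 𝓘(ℝ, E') F p (adjoint gM gN F p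
      (P (F p) (mfderiv 𝓘(ℝ, E) 𝓘(ℝ, E') F p (Y p)))) =
      P (F p) (mfderiv 𝓘(ℝ, E) 𝓘(ℝ, E') F p (Y p)) := by
    filter_upwards [hO.mem_nhds hq] with p hp
    exact hR.mfderiv_adjoint (hF.le_range₁ p (hF.apply_mem₁ (hY.2 p hp).2))
  have hn := hF.apply_mem₂ hz.2
  have h1 := hR.clairaut hf hF.clairaut hX hY' hXH (adjoint_mem_perp gM gN _) hn
  have h2 : gN.inner (F q) (mfderiv 𝓘(ℝ, E) 𝓘(ℝ, E') F q (leviCivita gM (fun p ↦ adjoint gM gN F p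
      (P (F p) (mfderiv 𝓘(ℝ, E) 𝓘(ℝ, E') F p (Y p)))) q (X q)))
      (P (F q) (mfderiv 𝓘(ℝ, E) 𝓘(ℝ, E') F q z)) = 0 :=
    hn _ (mfderiv_mem_range _)
  have h3 := hF.mvfderiv_eq_zero hP hf hdim hz.2
  change mvfderiv 𝓘(ℝ, E') f (F q) (P (F q) (mfderiv 𝓘(ℝ, E) 𝓘(ℝ, E') F q z)) = 0 at h3
  change gN.inner (F q) _ (P (F q) (mfderiv 𝓘(ℝ, E) 𝓘(ℝ, E') F q z)) = -(_ * mvfderiv 𝓘(ℝ, E') f (F q)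
    (P (F q) (mfderiv 𝓘(ℝ, E) 𝓘(ℝ, E') F q z))) at h1
  rw [h3, mul_zero, neg_zero, secondFundamentalForm, map_sub, _root_.sub_apply, h2, sub_zero,
    covDerivAlong_congr gN hFY' (X q), hPY, hP.isometry] at h1
  rw [hR.inner_leviCivita hX hYd hXH (hY.2 q hq).1 hz.1, h1]

/-- The lifts of D₁ and D₂ are orthogonal, so g(∇_X Y, Z) = -g(Y, ∇_X Z), and
`IsCSIRM.inner_leviCivita₁` applies to Z. -/
theorem IsCSIRM.inner_leviCivita₂ (hP : IsKahler gN P) (hf : ContMDiff 𝓘(ℝ, E') 𝓘(ℝ, ℝ) ∞ f)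
    (hF : IsCSIRM gM gN P F D₁ D₂ (fun y ↦ Real.exp (f y)))
    (hdim : 1 < Module.finrank ℝ (D₂ q)) {O : Set M} (hO : IsOpen O) (hq : q ∈ O)
    {X Y : Π x : M, TangentSpace 𝓘(ℝ, E) x} (hX : MDiffAt (T% X) q)
    (hXH : X q ∈ perp gM (ker (E := E) (E' := E') F q)) (hY : IsSectionOn (lift gM F D₂) O Y)
    {z : TangentSpace 𝓘(ℝ, E) q} (hz : z ∈ lift gM F D₁ q) :
    gM.inner q (leviCivita gM Y q (X q)) z = 0 := by
  have hR := hF.toIsRiemannianMap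
  obtain ⟨O', hO', hq', Z, hZ, rfl⟩ := exists_isSectionOn
    (hR.isSmoothSubbundleOn_lift hF.smooth₁ hF.le_range₁) (Set.mem_univ q) hz
  have h1 := leviCivita_metric gM hX (hY.mdiffAt hO hq) (hZ.mdiffAt hO' hq')
  have h2 : (fun p ↦ gM.inner p (Y p) (Z p)) =ᶠ[𝓝 q] fun _ ↦ 0 := by
    filter_upwards [hO.mem_nhds hq, hO'.mem_nhds hq'] with p hp hp'
    rw [← hR.inner_mfderiv (hY.2 p hp).1, gN.symm]
    exact hF.inner_eq_zero hP (hZ.2 p hp').2 (hY.2 p hp).2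
  rw [mvfderiv_congr h2, mvfderiv_const, gM.symm _ (Y q),
    hF.inner_leviCivita₁ hP hf hdim hO' hq' hX hXH hZ (hY.2 q hq), add_zero] at h1
  exact h1.symm

/-- If `∇_X Y` has no component in the complement `D'` of `D` in `range F_*`, then the lift of `D`
is totally geodesic if and only if it has no vertical second fundamental form. -/
theorem IsRiemannianMap.isTotallyGeodesicFoliation_lift_iff (hF : IsRiemannianMap gM gN F)
    {D D' : Π q : M, Submodule ℝ (TangentSpace 𝓘(ℝ, E') (F q))}
    (hD : IsSmoothSubbundleOn (EA := E) F D Set.univ)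
    (hsup : ∀ q, D q ⊔ D' q = range (E := E) (E' := E') F q)
    (hort : ∀ q, ∀ v ∈ D q, ∀ w ∈ D' q, gN.inner (F q) v w = 0)
    (h : ∀ O : Set M, IsOpen O → ∀ X Y, IsSectionOn (lift gM F D) O X →
      IsSectionOn (lift gM F D) O Y → ∀ q ∈ O, ∀ z ∈ lift gM F D' q,
      gM.inner q (leviCivita gM Y q (X q)) z = 0) :
    IsTotallyGeodesicFoliation gM (lift gM F D) ↔ NoComponent gM gN F D := by
  have hDR : ∀ q, D q ≤ range (E := E) (E' := E') F q := fun q ↦ hsup q ▸ le_sup_left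
  have hDR' : ∀ q, D' q ≤ range (E := E) (E' := E') F q := fun q ↦ hsup q ▸ le_sup_right
  have hsm := hF.isSmoothSubbundleOn_lift hD hDR
  constructor
  · intro hT O hO X U hX hU q hq e he
    -- To test (∇F_*)(X, U) against `e`, lift `e` to a section Y; the product is then the vertical
    -- part of ∇_X Y along U.
    obtain ⟨O', hO', hq', Y, hY, hYq⟩ := exists_isSectionOn hsm (Set.mem_univ q)
      (hF.adjoint_mem_lift hDR he)
    have h1 := (hT.totallyGeodesic _ (hO.inter hO') X Y (hX.mono Set.inter_subset_left)
      (hY.mono Set.inter_subset_right) q ⟨hq, hq'⟩).1 _ (hU.2 q hq)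
    have h2 := hF.inner_leviCivita_vertical (hX.mdiffAt hO hq) (hY.mdiffAt hO' hq')
      (hU.mdiffAt hO hq) (Filter.eventually_of_mem (hO'.mem_nhds hq') fun p hp ↦ (hY.2 p hp).1)
      (Filter.eventually_of_mem (hO.mem_nhds hq) hU.2)
    rw [hYq, hF.mfderiv_adjoint (hDR q he)] at h2
    exact h2.symm.trans h1
  · intro hN
    have htg : ∀ O : Set M, IsOpen O → ∀ X Y, IsSectionOn (lift gM F D) O X →
        IsSectionOn (lift gM F D) O Y → ∀ q ∈ O, leviCivita gM Y q (X q) ∈ lift gM F D q := by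
      intro O hO X Y hX hY q hq
      constructor
      · intro u hu
        obtain ⟨O', hO', hq', U, hU, rfl⟩ := hF.exists_isSectionOn_ker hu
        refine (hF.inner_leviCivita_vertical (hX.mdiffAt hO hq) (hY.mdiffAt hO hq)
          (hU.mdiffAt hO' hq') (Filter.eventually_of_mem (hO.mem_nhds hq) fun p hp ↦ (hY.2 p hp).1)
          (Filter.eventually_of_mem (hO'.mem_nhds hq') hU.2)).trans ?_
        exact hN _ (hO.inter hO') X U (hX.mono Set.inter_subset_left)
          (hU.mono Set.inter_subset_right) q ⟨hq, hq'⟩ _ (hY.2 q hq).2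
      · change mfderiv 𝓘(ℝ, E) 𝓘(ℝ, E') F q (leviCivita gM Y q (X q)) ∈ D q
        have hr := mfderiv_mem_range (F := F) (E' := E') (leviCivita gM Y q (X q))
        rw [← hsup] at hr
        obtain ⟨a, ha, b, hb, hab⟩ := Submodule.mem_sup.1 hr
        -- Testing with the lift of `b`, the D'-part of F_*(∇_X Y), gives g(b, b) = 0.
        have h1 := h O hO X Y hX hY q hq _ (hF.adjoint_mem_lift hDR' hb)
        rw [gM.symm, inner_adjoint, ← hab, map_add, gN.symm _ b a, hort q a ha b hb, zero_add] at h1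
        rw [← hab, inner_self_eq_zero gN h1, add_zero]
        exact ha
    refine ⟨hsm, fun O hO X Y hX hY q hq ↦ ?_, htg⟩
    -- Involutivity is a consequence: [X, Y] = ∇_X Y - ∇_Y X.
    rw [← leviCivita_torsion gM (hX.mdiffAt hO hq) (hY.mdiffAt hO hq)]
    exact Submodule.sub_mem _ (htg O hO X Y hX hY q hq) (htg O hO Y X hY hX q hq)

end ClairautMap

end RiemMap

end

/-! ### The main theorem. -/

theorem mainTheorem11
    {E : Type*} [NormedAddCommGroup E] [NormedSpace ℝ E] [FiniteDimensional ℝ E]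
    {M : Type*} [TopologicalSpace M] [ChartedSpace E M] [IsManifold 𝓘(ℝ, E) ∞ M]
    {E' : Type*} [NormedAddCommGroup E'] [NormedSpace ℝ E'] [FiniteDimensional ℝ E']
    {N : Type*} [TopologicalSpace N] [ChartedSpace E' N] [IsManifold 𝓘(ℝ, E') ∞ N]
    (gM : RiemMap.RMetric E M) (gN : RiemMap.RMetric E' N)
    (P : Π y : N, TangentSpace 𝓘(ℝ, E') y →L[ℝ] TangentSpace 𝓘(ℝ, E') y)
    (hP : RiemMap.IsKahler gN P)
    (F : M → N) (D₁ D₂ : Π q : M, Submodule ℝ (TangentSpace 𝓘(ℝ, E') (F q)))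
    (f : N → ℝ) (hf : ContMDiff 𝓘(ℝ, E') 𝓘(ℝ, ℝ) ∞ f)
    (hF : RiemMap.IsCSIRM gM gN P F D₁ D₂ (fun y ↦ Real.exp (f y)))
    (hdim : ∀ q, 1 < Module.finrank ℝ (D₂ q)) :
    (RiemMap.IsTotallyGeodesicFoliation gM (RiemMap.lift gM F D₁) ↔
      RiemMap.NoComponent gM gN F D₁) ∧
    (RiemMap.IsTotallyGeodesicFoliation gM (RiemMap.lift gM F D₂) ↔
      RiemMap.NoComponent gM gN F D₂) := by 
  have hR := hF.toIsRiemannianMap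
  constructor
  · exact hR.isTotallyGeodesicFoliation_lift_iff hF.smooth₁ hF.sup_eq
      (fun q v hv w hw ↦ hF.inner_eq_zero hP hv hw)
      fun O hO X Y hX hY q hq z hz ↦ hF.inner_leviCivita₁ hP hf (hdim q) hO hq
        (hX.mdiffAt hO hq) (hX.2 q hq).1 hY hz
  · exact hR.isTotallyGeodesicFoliation_lift_iff hF.smooth₂
      (fun q ↦ (sup_comm _ _).trans (hF.sup_eq q))
      (fun q v hv w hw ↦ (gN.symm _ _ _).trans (hF.inner_eq_zero hP hw hv))
      fun O hO X Y hX hY q hq z hz ↦ hF.inner_leviCivita₂ hP hf (hdim q) hO hq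
        (hX.mdiffAt hO hq) (hX.2 q hq).1 hY hz
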